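/- Fix real constants $g>0$ (gravity), $\gamma$ (vorticity) and $c$ (velocity). Let $H$ be the Hilbert transform on $\mathbb R$ (Fourier symbol $-i\,\mathrm{sgn}\,\xi$), $|D|=\partial_\alpha H$ (symbol $|\xi|$), and $\mathbf P=\frac12(I-iH)$ the projection onto negative frequencies. Consider the constant-vorticity water wave system in holomorphic coordinates $$W_t+(W_\alpha+1)\underline F+i\tfrac{\gamma}{2}W=0,\qquad Q_t-igW+\underline F\,Q_\alpha+i\gamma Q+\mathbf P\Big[\frac{|Q_\alpha|^2}{J}\Big]-i\tfrac{\gamma}{2}T_1=0,\tag{1}$$ where $J=|1+W_\alpha|^2$, $\underline F=\mathbf P\big[\frac{Q_\alpha-\bar Q_\alpha}{J}\big]-i\frac\gamma2\,\mathbf P\big[\frac{W}{1+\bar W_\alpha}+\frac{\bar W}{1+W_\alpha}\big]$, $T_1=\mathbf P\big[\frac{W\bar Q_\alpha}{1+\bar W_\alpha}-\frac{\bar WQ_\alpha}{1+W_\alpha}\big]$, and $W,Q$ are boundary values of holomorphic functions in the lower half-plane ($\mathbf PW=W$, $\mathbf PQ=Q$). Let $U\in H^2(\mathbb R)$ be a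 real-valued, nonzero solution of the Babenko equation $$(g+c\gamma-c^2|D|)U=-\tfrac{\gamma^2}{2}U^2-gU|D|U-\tfrac g2|D|U^2+\tfrac{\gamma^2}{2}\Big(U|D|U^2-U^2|D|U-\tfrac13|D|U^3\Big),$$ and put $$w=HU+iU,\qquad q=-cHU-\tfrac\gamma2H(U^2)+i\big(-cU-\tfrac\gamma2U^2\big).$$ Assume that the coordinates are nondegenerate, that is, $1+w_\alpha$ does not vanish on $\mathbb R$ and its holomorphic extension does not vanish in the lower half-plane. Then, for every $x_0\in\mathbb R$, $$W(\alpha,t)=w(\alpha+ct+x_0),\qquad Q(\alpha,t)=q(\alpha+ct+x_0)$$ is a solitary wave solution of (1): $w\neq0$, $w(\alpha)\to0$ as $|\alpha|\to\infty$, $W$ and $Q$ are continuously differentiable in $(\alpha,t)$, $W(\cdot,t),Q(\cdot,t)\in H^2(\mathbb R)$ satisfy $\mathbf PW=W$, $\mathbf PQ=Q$, the coordinates are nondegenerate at every time, and (1) holds (in $L^2_\alpha$) at every time $t$. -/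

import Mathlib

open MeasureTheory Filter Topology
open scoped ENNReal

noncomputable section

namespace ConstVorticity

/-- The Sobolev space `H^s(ℝ; ℂ)`, used for `s ≥ 1` only, so that its elements can be (and are)
identified with their continuous representatives. -/
def MemH (s : ℝ) (f : ℝ → ℂ) : Prop :=
  Continuous f ∧ ∃ h : MemLp f 2 (volume : Measure ℝ),
    TemperedDistribution.MemSobolev s 2 (Lp.toTemperedDistribution (h.toLp f))

/-- The Fourier transform on `L²(ℝ)` (normalised as `∫ e^{-2πixξ} f(x) dx`). -/
def l2Fourier (f : ℝ → ℂ) : Lp ℂ 2 (volume : Measure ℝ) :=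
  open Classical in
  if h : MemLp f 2 (volume : Measure ℝ) then FourierTransform.fourier (h.toLp f) else 0

/-- The continuous representative of the almost-everywhere class of `f` if there is one,
and `f` itself otherwise. -/
def contRep (f : ℝ → ℂ) : ℝ → ℂ :=
  open Classical in
  if h : ∃ k : ℝ → ℂ, Continuous k ∧ k =ᵐ[volume] f then h.choose else f

/-- The Fourier multiplier with symbol `m`, on the functions `f ∈ L²(ℝ)` with `m · f̂ ∈ L²(ℝ)`.
The value is an `L²` function, given by its continuous representative whenever it has one. -/
def fourierMultiplier (m : ℝ → ℂ) (f : ℝ → ℂ) : ℝ → ℂ :=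
  open Classical in
  if h : MemLp f 2 (volume : Measure ℝ) ∧
      MemLp (fun ξ => m ξ * l2Fourier f ξ) 2 (volume : Measure ℝ) then
    contRep (FourierTransformInv.fourierInv (h.2.toLp (fun ξ => m ξ * l2Fourier f ξ)) :
      Lp ℂ 2 (volume : Measure ℝ))
  else 0

/-- The Hilbert transform, with symbol `-i sgn ξ`. -/
def hilbert (f : ℝ → ℂ) : ℝ → ℂ :=
  fourierMultiplier (fun ξ => -Complex.I * (Real.sign ξ : ℂ)) f

/-- The operator `|D| = ∂_α H`; the factor `2π` comes from the normalisation of the Fourier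
transform. -/
def absD (f : ℝ → ℂ) : ℝ → ℂ :=
  fourierMultiplier (fun ξ => ((2 * Real.pi * |ξ| : ℝ) : ℂ)) f

/-- The projection `P = (I - iH) / 2` onto negative frequencies. -/
def proj (f : ℝ → ℂ) : ℝ → ℂ :=
  fun α => (f α - Complex.I * hilbert f α) / 2

/-- The holomorphic extension to the lower half-plane `Im z < 0` of a function `f ∈ L²(ℝ)`
with `P f = f`, as the Fourier-Laplace integral over the negative frequencies. -/
def lowerExt (f : ℝ → ℂ) (z : ℂ) : ℂ :=
  ∫ ξ in Set.Iio (0 : ℝ), Complex.exp (2 * Real.pi * Complex.I * ξ * z) * l2Fourier f ξ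

/-- The coordinate map `z ↦ z + W(z)` of the closed lower half-plane is nondegenerate: its
derivative `1 + W_α` vanishes neither on the real line nor in the open lower half-plane. -/
def NondegenerateCoordinates (w : ℝ → ℂ) : Prop :=
  (∀ α : ℝ, 1 + deriv w α ≠ 0) ∧ ∀ z : ℂ, z.im < 0 → 1 + deriv (lowerExt w) z ≠ 0

/-- `J = |1 + W_α|²`. -/
def jac (w : ℝ → ℂ) (α : ℝ) : ℂ := ((‖1 + deriv w α‖ ^ 2 : ℝ) : ℂ)

/-- `F = P[(Q_α - conj Q_α) / J]`. -/
def opF (w q : ℝ → ℂ) : ℝ → ℂ :=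
  proj fun α => (deriv q α - star (deriv q α)) / jac w α

/-- `F₁ = P[W / (1 + conj W_α) + conj W / (1 + W_α)]`. -/
def opF1 (w : ℝ → ℂ) : ℝ → ℂ :=
  proj fun α => w α / (1 + star (deriv w α)) + star (w α) / (1 + deriv w α)

/-- `F - i (γ/2) F₁`. -/
def opFbar (γ : ℝ) (w q : ℝ → ℂ) : ℝ → ℂ :=
  fun α => opF w q α - Complex.I * (γ / 2) * opF1 w α

/-- `T₁ = P[W conj Q_α / (1 + conj W_α) - conj W Q_α / (1 + W_α)]`. -/
def opT1 (w q : ℝ → ℂ) : ℝ → ℂ :=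
  proj fun α => w α * star (deriv q α) / (1 + star (deriv w α))
    - star (w α) * deriv q α / (1 + deriv w α)

/-- `(W, Q)`, written as functions of time and then space, is an `H²` solution of the water wave
system with constant vorticity `γ` and gravity `g` in holomorphic coordinates: all derivatives are
classical, and at every time both equations hold as identities between `L²` functions of `α`. -/
structure IsWaterWave (g γ : ℝ) (W Q : ℝ → ℝ → ℂ) : Prop where
  contDiff_W : ContDiff ℝ 1 (fun p : ℝ × ℝ => W p.1 p.2)
  contDiff_Q : ContDiff ℝ 1 (fun p : ℝ × ℝ => Q p.1 p.2)
  memH_W : ∀ t, MemH 2 (W t)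
  memH_Q : ∀ t, MemH 2 (Q t)
  holomorphic_W : ∀ t, proj (W t) = W t
  holomorphic_Q : ∀ t, proj (Q t) = Q t
  nondegenerate : ∀ t, NondegenerateCoordinates (W t)
  equation_W : ∀ t, ∀ᵐ α : ℝ,
    deriv (fun s => W s α) t + (deriv (W t) α + 1) * opFbar γ (W t) (Q t) α
      + Complex.I * (γ / 2) * W t α = 0
  equation_Q : ∀ t, ∀ᵐ α : ℝ,
    deriv (fun s => Q s α) t - Complex.I * g * W t α
      + opFbar γ (W t) (Q t) α * deriv (Q t) α + Complex.I * γ * Q t α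
      + proj (fun β => ((‖deriv (Q t) β‖ ^ 2 : ℝ) : ℂ) / jac (W t) β) α
      - Complex.I * (γ / 2) * opT1 (W t) (Q t) α = 0

/-- The profile `(w, q)` gives a (nonzero, localized) solitary wave
`(W, Q)(α, t) = (w, q)(α + c t)`. -/
structure IsSolitaryWave (g γ c : ℝ) (w q : ℝ → ℂ) : Prop where
  ne_zero : w ≠ 0
  tendsto_zero : Tendsto w (cocompact ℝ) (𝓝 0)
  isWaterWave : IsWaterWave g γ (fun t α => w (α + c * t)) (fun t α => q (α + c * t))

/-- The Babenko equation for the real-valued function `U`. -/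
def SolvesBabenko (g γ c : ℝ) (U : ℝ → ℝ) : Prop :=
  ∀ᵐ α : ℝ,
    ((g + c * γ : ℝ) : ℂ) * U α - (c : ℂ) ^ 2 * absD (fun x => (U x : ℂ)) α =
      - ((γ : ℂ) ^ 2 / 2) * (U α : ℂ) ^ 2
      - (g : ℂ) * U α * absD (fun x => (U x : ℂ)) α
      - (g : ℂ) / 2 * absD (fun x => (U x : ℂ) ^ 2) α
      + (γ : ℂ) ^ 2 / 2 *
        ((U α : ℂ) * absD (fun x => (U x : ℂ) ^ 2) α
          - (U α : ℂ) ^ 2 * absD (fun x => (U x : ℂ)) α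
          - 1 / 3 * absD (fun x => (U x : ℂ) ^ 3) α)

/-- `W = HU + iU`. -/
def profileW (U : ℝ → ℝ) : ℝ → ℂ :=
  fun α => hilbert (fun x => (U x : ℂ)) α + Complex.I * U α

/-- `Q = -cHU - (γ/2) H(U²) + i (-cU - (γ/2) U²)`. -/
def profileQ (γ c : ℝ) (U : ℝ → ℝ) : ℝ → ℂ :=
  fun α => -(c : ℂ) * hilbert (fun x => (U x : ℂ)) α
    - (γ : ℂ) / 2 * hilbert (fun x => (U x : ℂ) ^ 2) α
    + Complex.I * (-(c : ℂ) * U α - (γ : ℂ) / 2 * (U α : ℂ) ^ 2)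

end ConstVorticity

end

noncomputable section

namespace ConstVorticity

open scoped FourierTransform SchwartzMap ContDiff ComplexConjugate Interval

/-! ### The Fourier transform on `L²(ℝ)` through its pairing with test functions -/

/-! Every nonlinear term of the system has the form `P[h + conj m]`, where `h` and `m` are
square-integrable boundary values of bounded holomorphic functions in the lower half-plane. The
projection keeps `h` and kills `conj m` (`proj_eq_of_eq_add_conj`). Both equations therefore reduce
to pointwise algebra once such decompositions are found. Write `k = 1 / (1 + w_α)`.

For the transport velocity (`opFbar_profile`), the argument of `P` is `v - conj v` with `v = -(c w_α
+ i (γ/2) w) k`, so the velocity is `v`. This uses only the form of `q` in terms of `U`, and it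
gives the first equation at once.

The second equation rests on `bernoulli`: `N = |q_α k + c + γU|² - c² + 2gU` vanishes. The Babenko
equation says that `N (1 + w_α) = conj M` for an explicit boundary value `M` built from `w_α`,
`q_α`, `k` and the derivatives of `H(U²) + iU²` and `H(U³) + iU³`. Since `N` is real, `(1 + w_α) M =
N |1 + w_α|²` is at once real, in `L²` and holomorphic below, hence zero by
`LowerTrace.eq_zero_of_real`; nondegeneracy then gives `N = 0`. With this identity the remaining
projected terms combine to `E + conj E`, and the second equation cancels.

The analysis supports this algebra. `LowerTrace` functions form an algebra acting on `L²` that also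
contains constants and, by `exists_lowerTrace_inv`, the function `k`; the latter needs a uniform
lower bound for `|1 + w_α|` in the closed half-plane, obtained from decay at infinity.
Square-integrable members of this algebra have only negative frequencies, by Cauchy's theorem
(`LowerTrace.negFreq`). `H²` is closed under products and under `H`, so `w` and `q` are `C¹`.
Finally, everything commutes with translation, so each time slice is the profile of a translate of
`U`. -/

lemma l2Fourier_of_memLp {f : ℝ → ℂ} (h : MemLp f 2 (volume : Measure ℝ)) :
    l2Fourier f = 𝓕 (h.toLp f) := by
  simp [l2Fourier, h]

lemma memLp_l2Fourier (f : ℝ → ℂ) : MemLp (l2Fourier f) 2 (volume : Measure ℝ) := Lp.memLp _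

lemma l2Fourier_congr {f g : ℝ → ℂ} (h : f =ᵐ[volume] g) : l2Fourier f = l2Fourier g := by
  by_cases hf : MemLp f 2 (volume : Measure ℝ)
  · have hg := (memLp_congr_ae h).1 hf
    rw [l2Fourier_of_memLp hf, l2Fourier_of_memLp hg, (MemLp.toLp_eq_toLp_iff hf hg).2 h]
  · have hg : ¬ MemLp g 2 (volume : Measure ℝ) := fun hg => hf ((memLp_congr_ae h).2 hg)
    simp [l2Fourier, hf, hg]

lemma integral_mul_l2Fourier {f : ℝ → ℂ} (hf : MemLp f 2 (volume : Measure ℝ)) (φ : 𝓢(ℝ, ℂ)) :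
    ∫ x, φ x * l2Fourier f x = ∫ x, 𝓕 (φ : ℝ → ℂ) x * f x := by
  have h := Lp.fourier_toTemperedDistribution_eq (hf.toLp f)
  have h2 := congrArg (fun T : 𝓢'(ℝ, ℂ) => T φ) h
  simp only [TemperedDistribution.fourier_apply, Lp.toTemperedDistribution_apply,
    smul_eq_mul] at h2
  rw [l2Fourier_of_memLp hf, ← h2]
  refine integral_congr_ae ?_
  filter_upwards [hf.coeFn_toLp] with x hx
  rw [hx, SchwartzMap.fourier_coe]

/-- A real test function as a complex Schwartz function. -/
def testFun {g : ℝ → ℝ} (h₁ : ContDiff ℝ ∞ g) (h₂ : HasCompactSupport g) : 𝓢(ℝ, ℂ) :=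
  HasCompactSupport.toSchwartzMap (f := fun x => (g x : ℂ)) (h₂.comp_left Complex.ofReal_zero)
    (Complex.ofRealCLM.contDiff.comp h₁)

@[simp] lemma testFun_apply {g : ℝ → ℝ} (h₁ : ContDiff ℝ ∞ g) (h₂ : HasCompactSupport g) (x : ℝ) :
    testFun h₁ h₂ x = (g x : ℂ) := rfl

lemma ae_eq_of_integral_testFun {f g : ℝ → ℂ} (hf : LocallyIntegrable f) (hg : LocallyIntegrable g)
    (h : ∀ φ : 𝓢(ℝ, ℂ), ∫ x, φ x * f x = ∫ x, φ x * g x) : f =ᵐ[volume] g := by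
  refine ae_eq_of_integral_contDiff_smul_eq hf hg fun k h₁ h₂ => ?_
  simpa using h (testFun h₁ h₂)

lemma _root_.MeasureTheory.MemLp.locallyIntegrable_two {f : ℝ → ℂ}
    (hf : MemLp f 2 (volume : Measure ℝ)) : LocallyIntegrable f :=
  hf.locallyIntegrable (by norm_num)

lemma memLp_schwartz (φ : 𝓢(ℝ, ℂ)) : MemLp φ 2 (volume : Measure ℝ) := φ.memLp 2

lemma integrable_schwartz_mul {f : ℝ → ℂ} (hf : MemLp f 2 (volume : Measure ℝ)) (φ : 𝓢(ℝ, ℂ)) :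
    Integrable fun x => φ x * f x :=
  MemLp.integrable_mul (p := 2) (q := 2) (memLp_schwartz φ) hf

/-- The Fourier transform on `L²` is characterised by its pairing with Schwartz functions. -/
lemma l2Fourier_ae_eq {f g : ℝ → ℂ} (hf : MemLp f 2 (volume : Measure ℝ))
    (hg : LocallyIntegrable g)
    (h : ∀ (k : ℝ → ℝ) (h₁ : ContDiff ℝ ∞ k) (h₂ : HasCompactSupport k),
      ∫ x, testFun h₁ h₂ x * g x = ∫ x, 𝓕 (testFun h₁ h₂ : ℝ → ℂ) x * f x) :
    l2Fourier f =ᵐ[volume] g := by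
  refine ae_eq_of_integral_contDiff_smul_eq (memLp_l2Fourier f).locallyIntegrable_two hg
    fun k h₁ h₂ => ?_
  have := h k h₁ h₂
  rw [← integral_mul_l2Fourier hf] at this
  simpa using this.symm

lemma ae_eq_of_l2Fourier_ae_eq {f g : ℝ → ℂ} (hf : MemLp f 2 (volume : Measure ℝ))
    (hg : MemLp g 2 (volume : Measure ℝ)) (h : l2Fourier f =ᵐ[volume] l2Fourier g) :
    f =ᵐ[volume] g := by
  rw [l2Fourier_of_memLp hf, l2Fourier_of_memLp hg] at h
  have h2 : (𝓕 (hf.toLp f) : Lp ℂ 2 (volume : Measure ℝ)) = 𝓕 (hg.toLp g) := Lp.ext h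
  have h3 := (Lp.fourierTransformₗᵢ ℝ ℂ).injective h2
  exact (MemLp.toLp_eq_toLp_iff hf hg).1 h3

lemma l2Fourier_add {f g : ℝ → ℂ} (hf : MemLp f 2 (volume : Measure ℝ))
    (hg : MemLp g 2 (volume : Measure ℝ)) :
    l2Fourier (fun x => f x + g x) =ᵐ[volume] fun ξ => l2Fourier f ξ + l2Fourier g ξ := by
  have h : l2Fourier (fun x => f x + g x) = l2Fourier f + l2Fourier g := by
    rw [l2Fourier_of_memLp hf, l2Fourier_of_memLp hg,
      show (fun x => f x + g x) = f + g from rfl, l2Fourier_of_memLp (hf.add hg),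
      MemLp.toLp_add, FourierTransform.fourier_add]
  rw [h]
  exact Lp.coeFn_add _ _

lemma l2Fourier_const_mul {f : ℝ → ℂ} (hf : MemLp f 2 (volume : Measure ℝ)) (a : ℂ) :
    l2Fourier (fun x => a * f x) =ᵐ[volume] fun ξ => a * l2Fourier f ξ := by
  have h : l2Fourier (fun x => a * f x) = a • l2Fourier f := by
    rw [l2Fourier_of_memLp hf,
      show (fun x => a * f x) = a • f from rfl, l2Fourier_of_memLp (hf.const_smul a),
      MemLp.toLp_const_smul, FourierTransform.fourier_smul]
  rw [h]
  exact Lp.coeFn_smul _ _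

/-- Every `L²` function is the Fourier transform of its inverse Fourier transform. -/
lemma l2Fourier_fourierInv_toLp {φ : ℝ → ℂ} (hφ : MemLp φ 2 (volume : Measure ℝ)) :
    l2Fourier (FourierTransformInv.fourierInv (hφ.toLp φ) : Lp ℂ 2 (volume : Measure ℝ))
      =ᵐ[volume] φ := by
  have h : MemLp (FourierTransformInv.fourierInv (hφ.toLp φ) : Lp ℂ 2 (volume : Measure ℝ)) 2
    (volume : Measure ℝ) := Lp.memLp _
  rw [l2Fourier_of_memLp h, Lp.toLp_coeFn, FourierTransform.fourier_fourierInv_eq]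
  exact hφ.coeFn_toLp

lemma integral_fourier_mul {f g : ℝ → ℂ} (hf : Integrable f) (hg : Integrable g) :
    ∫ x, 𝓕 f x * g x = ∫ x, f x * 𝓕 g x := by
  have := VectorFourier.integral_fourierIntegral_smul_eq_flip (e := Real.fourierChar)
    (μ := (volume : Measure ℝ)) (ν := (volume : Measure ℝ)) (L := innerₗ ℝ)
    Real.continuous_fourierChar (by fun_prop) hf hg
  simpa [Real.fourier_eq, VectorFourier.fourierIntegral, mul_comm] using! this

lemma integral_fourierInv_mul {f g : ℝ → ℂ} (hf : Integrable f) (hg : Integrable g) :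
    ∫ x, 𝓕⁻ f x * g x = ∫ x, f x * 𝓕⁻ g x := by
  have h := integral_fourier_mul hf.comp_neg hg
  rw [Real.fourierInv_eq_fourier_comp_neg, h,
    ← integral_neg_eq_self (fun x => f (-x) * 𝓕 g x)]
  simp [Real.fourierInv_eq_fourier_neg]

lemma continuous_fourierInv {φ : ℝ → ℂ} (hφ : Integrable φ) : Continuous (𝓕⁻ φ) := by
  rw [Real.fourierInv_eq_fourier_comp_neg]
  exact VectorFourier.fourierIntegral_continuous Real.continuous_fourierChar
    (by fun_prop) hφ.comp_neg

/-- For integrable square-integrable functions the inverse Fourier transform is the integral. -/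
lemma l2Fourier_fourierInv {φ : ℝ → ℂ} (hφ : MemLp φ 2 (volume : Measure ℝ))
    (hφ₁ : Integrable φ) :
    MemLp (𝓕⁻ φ) 2 (volume : Measure ℝ) ∧ l2Fourier (𝓕⁻ φ) =ᵐ[volume] φ := by
  set f : Lp ℂ 2 (volume : Measure ℝ) := FourierTransformInv.fourierInv (hφ.toLp φ)
  have hf : MemLp f 2 (volume : Measure ℝ) := Lp.memLp _
  have hfφ : l2Fourier f =ᵐ[volume] φ := l2Fourier_fourierInv_toLp hφ
  have key : f =ᵐ[volume] 𝓕⁻ φ := by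
    refine ae_eq_of_integral_testFun hf.locallyIntegrable_two
      (continuous_fourierInv hφ₁).locallyIntegrable fun ψ => ?_
    have h1 := integral_mul_l2Fourier hf (𝓕⁻ ψ)
    have h2 : 𝓕 ((𝓕⁻ ψ : 𝓢(ℝ, ℂ)) : ℝ → ℂ) = ψ := by
      rw [← SchwartzMap.fourier_coe, FourierTransform.fourier_fourierInv_eq]
    rw [h2] at h1
    rw [← h1, ← integral_fourierInv_mul ψ.integrable hφ₁]
    refine integral_congr_ae ?_
    filter_upwards [hfφ] with x hx
    rw [hx, SchwartzMap.fourierInv_coe]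
  exact ⟨(memLp_congr_ae key).1 hf, by rw [← l2Fourier_congr key]; exact hfφ⟩

lemma eq_of_ae_eq_of_continuous {f g : ℝ → ℂ} (hf : Continuous f) (hg : Continuous g)
    (h : f =ᵐ[volume] g) : f = g :=
  (Continuous.ae_eq_iff_eq volume hf hg).1 h

lemma eq_fourierInv {f : ℝ → ℂ} (hf : MemLp f 2 (volume : Measure ℝ)) (hc : Continuous f)
    (hi : Integrable (l2Fourier f)) : f = 𝓕⁻ (l2Fourier f : ℝ → ℂ) := by
  obtain ⟨h1, h2⟩ := l2Fourier_fourierInv (memLp_l2Fourier f) hi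
  exact eq_of_ae_eq_of_continuous hc (continuous_fourierInv hi)
    (ae_eq_of_l2Fourier_ae_eq hf h1 h2.symm)

/-! ### Symmetries of the Fourier transform -/

lemma quasiMeasurePreserving_add_right (a : ℝ) :
    Measure.QuasiMeasurePreserving (fun x : ℝ => x + a) volume volume :=
  (measurePreserving_add_right volume a).quasiMeasurePreserving

lemma memLp_comp_add {f : ℝ → ℂ} (hf : MemLp f 2 (volume : Measure ℝ)) (a : ℝ) :
    MemLp (fun x => f (x + a)) 2 (volume : Measure ℝ) :=
  hf.comp_measurePreserving (measurePreserving_add_right volume a)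

lemma memLp_conj {f : ℝ → ℂ} (hf : MemLp f 2 (volume : Measure ℝ)) :
    MemLp (fun x => conj (f x)) 2 (volume : Measure ℝ) := hf.star

lemma memLp_comp_neg {f : ℝ → ℂ} (hf : MemLp f 2 (volume : Measure ℝ)) :
    MemLp (fun x => f (-x)) 2 (volume : Measure ℝ) :=
  hf.comp_measurePreserving (Measure.measurePreserving_neg volume)

/-- The character `ξ ↦ e^{2πiaξ}`. -/
def expChar (a ξ : ℝ) : ℂ := Complex.exp (2 * Real.pi * Complex.I * a * ξ)

lemma norm_expChar (a ξ : ℝ) : ‖expChar a ξ‖ = 1 := by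
  rw [expChar, Complex.norm_exp]; simp

lemma contDiff_expChar (a : ℝ) : ContDiff ℝ ∞ (expChar a) := by
  unfold expChar
  have : ContDiff ℝ ∞ (fun ξ : ℝ => (ξ : ℂ)) := Complex.ofRealCLM.contDiff
  fun_prop

lemma memLp_expChar_mul {f : ℝ → ℂ} (hf : MemLp f 2 (volume : Measure ℝ)) (a : ℝ) :
    MemLp (fun ξ => expChar a ξ * f ξ) 2 (volume : Measure ℝ) := by
  refine hf.of_le ((contDiff_expChar a).continuous.aestronglyMeasurable.mul hf.1) ?_
  filter_upwards with x
  simp [norm_expChar]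

lemma l2Fourier_comp_add {f : ℝ → ℂ} (hf : MemLp f 2 (volume : Measure ℝ)) (a : ℝ) :
    l2Fourier (fun x => f (x + a)) =ᵐ[volume] fun ξ => expChar a ξ * l2Fourier f ξ := by
  refine l2Fourier_ae_eq (memLp_comp_add hf a)
    (memLp_expChar_mul (memLp_l2Fourier f) a).locallyIntegrable_two fun k h₁ h₂ => ?_
  have hs : HasCompactSupport fun ξ => expChar a ξ * testFun h₁ h₂ ξ :=
    (HasCompactSupport.comp_left (g := Complex.ofReal) h₂ Complex.ofReal_zero).mul_left
  have hd : ContDiff ℝ ∞ fun ξ => expChar a ξ * testFun h₁ h₂ ξ :=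
    (contDiff_expChar a).mul (SchwartzMap.smooth _ _)
  have h := integral_mul_l2Fourier hf (hs.toSchwartzMap hd)
  -- Modulating the test function translates its Fourier transform, which turns the pairing into a
  -- change of variables.
  have e : ∀ x, 𝓕 (hs.toSchwartzMap hd : ℝ → ℂ) x = 𝓕 (testFun h₁ h₂ : ℝ → ℂ) (x - a) := by
    intro x
    rw [Real.fourier_real_eq_integral_exp_smul, Real.fourier_real_eq_integral_exp_smul]
    refine integral_congr_ae (ae_of_all _ fun v => ?_)
    change _ * (expChar a v * testFun h₁ h₂ v) = _ * testFun h₁ h₂ v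
    rw [expChar, ← mul_assoc, ← Complex.exp_add]
    congr 2
    push_cast
    ring
  simp only [e] at h
  rw [← integral_sub_right_eq_self (fun x => 𝓕 (testFun h₁ h₂ : ℝ → ℂ) x * f (x + a)) a]
  simp only [sub_add_cancel, ← h]
  refine integral_congr_ae (ae_of_all _ fun v => ?_)
  change _ = expChar a v * testFun h₁ h₂ v * _
  ring

lemma l2Fourier_conj {f : ℝ → ℂ} (hf : MemLp f 2 (volume : Measure ℝ)) :
    l2Fourier (fun x => conj (f x)) =ᵐ[volume] fun ξ => conj (l2Fourier f (-ξ)) := by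
  refine l2Fourier_ae_eq (memLp_conj hf)
    (memLp_conj (memLp_comp_neg (memLp_l2Fourier f))).locallyIntegrable_two fun k h₁ h₂ => ?_
  have h₁' : ContDiff ℝ ∞ fun x => k (-x) := h₁.comp contDiff_neg
  have h₂' : HasCompactSupport fun x => k (-x) := h₂.comp_homeomorph (Homeomorph.neg ℝ)
  have h := congrArg conj (integral_mul_l2Fourier hf (testFun h₁' h₂'))
  rw [← integral_conj, ← integral_conj] at h
  have e : ∀ x, conj (𝓕 (testFun h₁' h₂' : ℝ → ℂ) x) = 𝓕 (testFun h₁ h₂ : ℝ → ℂ) x := by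
    intro x
    rw [Real.fourier_real_eq_integral_exp_smul, Real.fourier_real_eq_integral_exp_smul,
      ← integral_conj, ← integral_neg_eq_self]
    refine integral_congr_ae (ae_of_all _ fun v => ?_)
    simp [← Complex.exp_conj, Complex.conj_ofNat]
  simp only [map_mul, e] at h
  rw [← h, ← integral_neg_eq_self]
  refine integral_congr_ae (ae_of_all _ fun v => ?_)
  simp

/-- Integration by parts for the Fourier transform on `L²`. -/
lemma l2Fourier_of_hasDerivAt {f f' : ℝ → ℂ} (hf : MemLp f 2 (volume : Measure ℝ))
    (hf' : MemLp f' 2 (volume : Measure ℝ)) (hd : ∀ x, HasDerivAt f (f' x) x) :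
    l2Fourier f' =ᵐ[volume] fun ξ => 2 * Real.pi * Complex.I * ξ * l2Fourier f ξ := by
  have hli : LocallyIntegrable fun ξ : ℝ => 2 * Real.pi * Complex.I * ξ * l2Fourier f ξ := by
    have : Continuous fun ξ : ℝ => 2 * Real.pi * Complex.I * (ξ : ℂ) := by fun_prop
    simpa only [smul_eq_mul, locallyIntegrableOn_univ] using
      ((memLp_l2Fourier f).locallyIntegrable_two.locallyIntegrableOn
        Set.univ).continuousOn_smul isOpen_univ.isLocallyClosed this.continuousOn
  refine l2Fourier_ae_eq hf' hli fun k h₁ h₂ => ?_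
  have hs : HasCompactSupport fun ξ : ℝ => 2 * Real.pi * Complex.I * ξ * testFun h₁ h₂ ξ :=
    (HasCompactSupport.comp_left (g := Complex.ofReal) h₂ Complex.ofReal_zero).mul_left
  have hsm : ContDiff ℝ ∞ fun ξ : ℝ => 2 * Real.pi * Complex.I * ξ * testFun h₁ h₂ ξ := by
    have : ContDiff ℝ ∞ (fun ξ : ℝ => (ξ : ℂ)) := Complex.ofRealCLM.contDiff
    have := SchwartzMap.smooth (testFun h₁ h₂) (⊤ : ℕ∞)
    fun_prop
  set ψ : 𝓢(ℝ, ℂ) := hs.toSchwartzMap hsm with hψ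
  have hψv : ∀ ξ, ψ ξ = 2 * Real.pi * Complex.I * ξ * testFun h₁ h₂ ξ := fun _ => rfl
  have hD : ∀ x, HasDerivAt (𝓕 (testFun h₁ h₂ : ℝ → ℂ)) (-𝓕 (ψ : ℝ → ℂ) x) x := by
    intro x
    have hi : Integrable fun ξ : ℝ => ξ • testFun h₁ h₂ ξ := by
      refine (ψ.integrable.const_mul (2 * Real.pi * Complex.I)⁻¹).congr (ae_of_all _ fun ξ => ?_)
      simp only [hψv, Complex.real_smul]
      have : (2 * Real.pi * Complex.I : ℂ) ≠ 0 := Complex.two_pi_I_ne_zero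
      field_simp
    have e : -𝓕 (ψ : ℝ → ℂ) x =
        𝓕 (fun x : ℝ => (-2 * Real.pi * Complex.I * x) • testFun h₁ h₂ x) x := by
      rw [Real.fourier_real_eq, Real.fourier_real_eq, ← integral_neg]
      refine integral_congr_ae (ae_of_all _ fun v => ?_)
      simp [hψv, Circle.smul_def]
    rw [e]
    exact Real.hasDerivAt_fourier (testFun h₁ h₂).integrable hi x
  have h := integral_mul_l2Fourier hf ψ
  have hF (φ : 𝓢(ℝ, ℂ)) : (𝓕 (φ : ℝ → ℂ)) = (𝓕 φ : 𝓢(ℝ, ℂ)) := rfl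
  have hp := integral_mul_deriv_eq_deriv_mul_of_integrable (u := 𝓕 (testFun h₁ h₂ : ℝ → ℂ))
    (u' := fun x => -𝓕 (ψ : ℝ → ℂ) x) (v := f) (fun x _ => hD x) (fun x _ => hd x)
    (by rw [hF]; exact integrable_schwartz_mul hf' _)
    (by
      rw [hF]
      refine (integrable_schwartz_mul hf (𝓕 ψ)).neg.congr (ae_of_all _ fun v => ?_)
      simp [SchwartzMap.fourier_coe])
    (by rw [hF]; exact integrable_schwartz_mul hf _)
  rw [hp, ← integral_neg]
  simp only [neg_mul, neg_neg]
  rw [← h]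
  refine integral_congr_ae (ae_of_all _ fun v => ?_)
  simp only [hψv]
  ring

/-! ### The Sobolev space `H²` on the Fourier side -/

lemma memLp_of_norm_le {f g : ℝ → ℂ} (hg : MemLp g 2 (volume : Measure ℝ))
    (hf : AEStronglyMeasurable f volume) (h : ∀ x, ‖f x‖ ≤ ‖g x‖) :
    MemLp f 2 (volume : Measure ℝ) :=
  hg.of_le hf (ae_of_all _ h)

lemma memLp_bdd_mul {f m : ℝ → ℂ} (hf : MemLp f 2 (volume : Measure ℝ))
    (hm : AEStronglyMeasurable m volume) {C : ℝ} (hC : ∀ x, ‖m x‖ ≤ C) :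
    MemLp (fun x => m x * f x) 2 (volume : Measure ℝ) := by
  refine hf.of_le_mul (c := C) (hm.mul hf.1) (ae_of_all _ fun x => ?_)
  rw [norm_mul]
  gcongr
  exact hC x

/-- At `s = 2` the Bessel weight `(1 + ξ²)^(s/2)` is a polynomial, so it can be moved onto the test
function explicitly. This makes the distributional Sobolev condition comparable with a weighted `L²`
condition on `l2Fourier f`. -/
lemma smulLeftCLM_weight_apply (T : 𝓢'(ℝ, ℂ)) (φ : 𝓢(ℝ, ℂ)) :
    ∃ ψ : 𝓢(ℝ, ℂ), (∀ x, ψ x = (1 + (x : ℂ) ^ 2) * φ x) ∧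
      TemperedDistribution.smulLeftCLM ℂ
        (fun x : ℝ => (((1 + ‖x‖ ^ 2) ^ ((2 : ℝ) / 2) : ℝ) : ℂ)) T φ = T ψ := by
  refine ⟨_, fun x => ?_, TemperedDistribution.smulLeftCLM_apply_apply _ _ _⟩
  rw [SchwartzMap.smulLeftCLM_apply_apply (by fun_prop)]
  simp

lemma memH_two_iff {f : ℝ → ℂ} : MemH 2 f ↔ Continuous f ∧ MemLp f 2 (volume : Measure ℝ) ∧
    MemLp (fun ξ : ℝ => (1 + (ξ : ℂ) ^ 2) * l2Fourier f ξ) 2 (volume : Measure ℝ) := by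
  have hli : LocallyIntegrable fun ξ : ℝ => (1 + (ξ : ℂ) ^ 2) * l2Fourier f ξ := by
    have : Continuous fun ξ : ℝ => (1 + (ξ : ℂ) ^ 2) := by fun_prop
    simpa only [smul_eq_mul, locallyIntegrableOn_univ] using
      ((memLp_l2Fourier f).locallyIntegrable_two.locallyIntegrableOn
        Set.univ).continuousOn_smul isOpen_univ.isLocallyClosed this.continuousOn
  unfold MemH
  refine and_congr_right fun hc => ⟨fun ⟨h, hs⟩ => ⟨h, ?_⟩, fun ⟨h, hs⟩ => ⟨h, ?_⟩⟩
  · rw [TemperedDistribution.memSobolev_iff_exists_smulLeftCLM_fourier] at hs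
    obtain ⟨f', hf'⟩ := hs
    have hm : MemLp f' 2 (volume : Measure ℝ) := Lp.memLp _
    refine (memLp_congr_ae (ae_eq_of_integral_testFun hm.locallyIntegrable_two hli
      fun φ => ?_)).1 hm
    obtain ⟨ψ, h1, h2⟩ := smulLeftCLM_weight_apply (𝓕 (h.toLp f : 𝓢'(ℝ, ℂ))) φ
    rw [hf', Lp.fourier_toTemperedDistribution_eq, ← l2Fourier_of_memLp h] at h2
    simp only [Lp.toTemperedDistribution_apply, smul_eq_mul, h1] at h2
    rw [h2]
    refine integral_congr_ae (ae_of_all _ fun v => ?_)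
    ring
  · rw [TemperedDistribution.memSobolev_iff_exists_smulLeftCLM_fourier]
    refine ⟨hs.toLp _, ?_⟩
    ext φ
    obtain ⟨ψ, h1, h2⟩ := smulLeftCLM_weight_apply (𝓕 (h.toLp f : 𝓢'(ℝ, ℂ))) φ
    rw [h2, Lp.fourier_toTemperedDistribution_eq, ← l2Fourier_of_memLp h]
    simp only [Lp.toTemperedDistribution_apply, smul_eq_mul, h1]
    refine integral_congr_ae ?_
    filter_upwards [hs.coeFn_toLp] with v hv
    rw [hv]
    ring

lemma norm_one_add_sq (ξ : ℝ) : ‖(1 + (ξ : ℂ) ^ 2)‖ = 1 + ξ ^ 2 := by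
  rw [show (1 + (ξ : ℂ) ^ 2) = ((1 + ξ ^ 2 : ℝ) : ℂ) by push_cast; rfl, Complex.norm_real,
    Real.norm_of_nonneg (by positivity)]

lemma one_add_sq_ne_zero (ξ : ℝ) : (1 + (ξ : ℂ) ^ 2) ≠ 0 := by
  rw [← norm_pos_iff, norm_one_add_sq]; positivity

lemma memLp_inv_weight : MemLp (fun ξ : ℝ => (1 + (ξ : ℂ) ^ 2)⁻¹) 2 (volume : Measure ℝ) := by
  have hc : Continuous fun ξ : ℝ => (1 + (ξ : ℂ) ^ 2)⁻¹ :=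
    Continuous.inv₀ (by fun_prop) one_add_sq_ne_zero
  rw [memLp_two_iff_integrable_sq_norm hc.aestronglyMeasurable]
  refine integrable_inv_one_add_sq.mono' (hc.norm.pow 2).aestronglyMeasurable
    (ae_of_all _ fun ξ => ?_)
  rw [norm_inv, norm_one_add_sq, Real.norm_of_nonneg (by positivity)]
  have : (1 + ξ ^ 2)⁻¹ ≤ 1 := inv_le_one_of_one_le₀ (by nlinarith [sq_nonneg ξ])
  have h0 : 0 ≤ (1 + ξ ^ 2)⁻¹ := by positivity
  nlinarith

lemma memLp_mul_inv_weight :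
    MemLp (fun ξ : ℝ => (ξ : ℂ) * (1 + (ξ : ℂ) ^ 2)⁻¹) 2 (volume : Measure ℝ) := by
  have hc : Continuous fun ξ : ℝ => (ξ : ℂ) * (1 + (ξ : ℂ) ^ 2)⁻¹ :=
    Complex.continuous_ofReal.mul (Continuous.inv₀ (by fun_prop) one_add_sq_ne_zero)
  rw [memLp_two_iff_integrable_sq_norm hc.aestronglyMeasurable]
  refine integrable_inv_one_add_sq.mono' (hc.norm.pow 2).aestronglyMeasurable
    (ae_of_all _ fun ξ => ?_)
  rw [norm_mul, norm_inv, norm_one_add_sq, Real.norm_of_nonneg (by positivity),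
    Complex.norm_real, mul_pow, Real.norm_eq_abs, sq_abs]
  have h1 : 0 < 1 + ξ ^ 2 := by positivity
  field_simp
  nlinarith [sq_nonneg ξ]

lemma aestronglyMeasurable_of_weight {φ : ℝ → ℂ}
    (hφ : MemLp (fun ξ : ℝ => (1 + (ξ : ℂ) ^ 2) * φ ξ) 2 (volume : Measure ℝ)) :
    AEStronglyMeasurable φ volume := by
  refine (memLp_inv_weight.1.mul hφ.1).congr (ae_of_all _ fun ξ => ?_)
  simp only [Pi.mul_apply]
  field_simp [one_add_sq_ne_zero ξ]

lemma memLp_of_weight {φ : ℝ → ℂ}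
    (hφ : MemLp (fun ξ : ℝ => (1 + (ξ : ℂ) ^ 2) * φ ξ) 2 (volume : Measure ℝ)) :
    MemLp φ 2 (volume : Measure ℝ) := by
  refine memLp_of_norm_le hφ (aestronglyMeasurable_of_weight hφ) fun ξ => ?_
  rw [norm_mul, norm_one_add_sq]
  nlinarith [sq_nonneg ξ, norm_nonneg (φ ξ), mul_nonneg (sq_nonneg ξ) (norm_nonneg (φ ξ))]

lemma memLp_mul_of_weight {φ : ℝ → ℂ}
    (hφ : MemLp (fun ξ : ℝ => (1 + (ξ : ℂ) ^ 2) * φ ξ) 2 (volume : Measure ℝ)) :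
    MemLp (fun ξ : ℝ => (ξ : ℂ) * φ ξ) 2 (volume : Measure ℝ) := by
  refine memLp_of_norm_le hφ (Complex.continuous_ofReal.aestronglyMeasurable.mul
    (aestronglyMeasurable_of_weight hφ)) fun ξ => ?_
  rw [norm_mul, norm_mul, norm_one_add_sq, Complex.norm_real, Real.norm_eq_abs]
  gcongr
  nlinarith [sq_abs ξ, sq_nonneg (|ξ| - 1)]

lemma integrable_of_weight {φ : ℝ → ℂ}
    (hφ : MemLp (fun ξ : ℝ => (1 + (ξ : ℂ) ^ 2) * φ ξ) 2 (volume : Measure ℝ)) :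
    Integrable φ := by
  refine (MemLp.integrable_mul (p := 2) (q := 2) memLp_inv_weight hφ).congr
    (ae_of_all _ fun ξ => ?_)
  simp only [Pi.mul_apply]
  field_simp [one_add_sq_ne_zero ξ]

/-- Cauchy–Schwarz against `ξ / (1 + ξ²)`, which lies in `L²`. Together with `integrable_of_weight`
this is the embedding of `H²` into `C¹`, seen on the Fourier side: Fourier inversion may be
differentiated once under the integral. -/
lemma integrable_mul_of_weight {φ : ℝ → ℂ}
    (hφ : MemLp (fun ξ : ℝ => (1 + (ξ : ℂ) ^ 2) * φ ξ) 2 (volume : Measure ℝ)) :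
    Integrable fun ξ : ℝ => (ξ : ℂ) * φ ξ := by
  refine (MemLp.integrable_mul (p := 2) (q := 2) memLp_mul_inv_weight hφ).congr
    (ae_of_all _ fun ξ => ?_)
  simp only [Pi.mul_apply]
  field_simp [one_add_sq_ne_zero ξ]

lemma MemH.continuous {f : ℝ → ℂ} (hf : MemH 2 f) : Continuous f := hf.1

lemma MemH.memLp {f : ℝ → ℂ} (hf : MemH 2 f) : MemLp f 2 (volume : Measure ℝ) :=
  (memH_two_iff.1 hf).2.1

lemma MemH.weight {f : ℝ → ℂ} (hf : MemH 2 f) :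
    MemLp (fun ξ : ℝ => (1 + (ξ : ℂ) ^ 2) * l2Fourier f ξ) 2 (volume : Measure ℝ) :=
  (memH_two_iff.1 hf).2.2

lemma MemH.eq_fourierInv {f : ℝ → ℂ} (hf : MemH 2 f) : f = 𝓕⁻ (l2Fourier f : ℝ → ℂ) :=
  ConstVorticity.eq_fourierInv hf.memLp hf.continuous (integrable_of_weight hf.weight)

lemma norm_fourierInv_le (φ : ℝ → ℂ) (x : ℝ) : ‖𝓕⁻ φ x‖ ≤ ∫ ξ, ‖φ ξ‖ := by
  rw [Real.fourierInv_eq]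
  refine (norm_integral_le_integral_norm _).trans_eq ?_
  simp [Circle.norm_smul]

lemma MemH.bounded {f : ℝ → ℂ} (hf : MemH 2 f) : ∃ C, ∀ x, ‖f x‖ ≤ C :=
  ⟨_, fun x => by rw [hf.eq_fourierInv]; exact norm_fourierInv_le _ x⟩

lemma fourierInv_apply_eq (φ : ℝ → ℂ) (x : ℝ) :
    𝓕⁻ φ x = ∫ ξ : ℝ, Complex.exp (2 * Real.pi * Complex.I * ξ * x) * φ ξ := by
  rw [Real.fourierInv_eq']
  refine integral_congr_ae (ae_of_all _ fun ξ => ?_)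
  have e : inner ℝ ξ x = x * ξ := by simp
  simp only [smul_eq_mul, e]
  congr 2
  push_cast
  ring

lemma hasDerivAt_fourierInv {φ : ℝ → ℂ} (h0 : Integrable φ)
    (h1 : Integrable fun ξ : ℝ => (ξ : ℂ) * φ ξ) (x : ℝ) :
    HasDerivAt (𝓕⁻ φ) (𝓕⁻ (fun ξ : ℝ => 2 * Real.pi * Complex.I * ξ * φ ξ) x) x := by
  have hi : Integrable fun ξ : ℝ => ξ • φ (-ξ) := by
    refine h1.comp_neg.neg.congr (ae_of_all _ fun ξ => ?_)
    simp
  have h := Real.hasDerivAt_fourier h0.comp_neg hi x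
  rw [Real.fourierInv_eq_fourier_comp_neg, Real.fourierInv_eq_fourier_comp_neg]
  have e : (fun ξ : ℝ => 2 * Real.pi * Complex.I * ((-ξ : ℝ) : ℂ) * φ (-ξ)) =
      fun ξ : ℝ => (-2 * Real.pi * Complex.I * ξ) • φ (-ξ) := by
    ext ξ
    simp
  rw [e]
  exact h

lemma MemH.hasDerivAt_aux {f : ℝ → ℂ} (hf : MemH 2 f) (x : ℝ) :
    HasDerivAt f (𝓕⁻ (fun ξ : ℝ => 2 * Real.pi * Complex.I * ξ * l2Fourier f ξ) x) x := by
  have h := hasDerivAt_fourierInv (integrable_of_weight hf.weight)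
    (integrable_mul_of_weight hf.weight) x
  rwa [← hf.eq_fourierInv] at h

lemma MemH.deriv_eq {f : ℝ → ℂ} (hf : MemH 2 f) :
    deriv f = 𝓕⁻ (fun ξ : ℝ => 2 * Real.pi * Complex.I * ξ * l2Fourier f ξ) :=
  funext fun x => (hf.hasDerivAt_aux x).deriv

lemma MemH.hasDerivAt {f : ℝ → ℂ} (hf : MemH 2 f) (x : ℝ) : HasDerivAt f (deriv f x) x :=
  (hf.hasDerivAt_aux x).differentiableAt.hasDerivAt

lemma MemH.integrable_deriv_symbol {f : ℝ → ℂ} (hf : MemH 2 f) :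
    Integrable fun ξ : ℝ => 2 * Real.pi * Complex.I * ξ * l2Fourier f ξ := by
  simpa only [mul_assoc] using
    (integrable_mul_of_weight hf.weight).const_mul (2 * Real.pi * Complex.I)

lemma MemH.memLp_deriv_symbol {f : ℝ → ℂ} (hf : MemH 2 f) :
    MemLp (fun ξ : ℝ => 2 * Real.pi * Complex.I * ξ * l2Fourier f ξ) 2 (volume : Measure ℝ) := by
  simpa only [mul_assoc] using!
    (memLp_mul_of_weight hf.weight).const_mul (2 * Real.pi * Complex.I)

lemma MemH.memLp_deriv {f : ℝ → ℂ} (hf : MemH 2 f) :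
    MemLp (deriv f) 2 (volume : Measure ℝ) := by
  rw [hf.deriv_eq]
  exact (l2Fourier_fourierInv hf.memLp_deriv_symbol hf.integrable_deriv_symbol).1

lemma MemH.l2Fourier_deriv {f : ℝ → ℂ} (hf : MemH 2 f) :
    l2Fourier (deriv f) =ᵐ[volume] fun ξ => 2 * Real.pi * Complex.I * ξ * l2Fourier f ξ := by
  rw [hf.deriv_eq]
  exact (l2Fourier_fourierInv hf.memLp_deriv_symbol hf.integrable_deriv_symbol).2

lemma MemH.continuous_deriv {f : ℝ → ℂ} (hf : MemH 2 f) : Continuous (deriv f) := by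
  rw [hf.deriv_eq]
  exact continuous_fourierInv hf.integrable_deriv_symbol

lemma MemH.bounded_deriv {f : ℝ → ℂ} (hf : MemH 2 f) : ∃ C, ∀ x, ‖deriv f x‖ ≤ C :=
  ⟨_, fun x => by rw [hf.deriv_eq]; exact norm_fourierInv_le _ x⟩

lemma MemH.contDiff {f : ℝ → ℂ} (hf : MemH 2 f) : ContDiff ℝ 1 f :=
  contDiff_one_iff_deriv.2 ⟨fun x => (hf.hasDerivAt x).differentiableAt, hf.continuous_deriv⟩

lemma MemH.tendsto_zero {f : ℝ → ℂ} (hf : MemH 2 f) : Tendsto f (cocompact ℝ) (𝓝 0) := by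
  rw [hf.eq_fourierInv, Real.fourierInv_eq_fourier_comp_neg]
  exact Real.zero_at_infty_fourier _

lemma MemH.const_mul {f : ℝ → ℂ} (hf : MemH 2 f) (a : ℂ) : MemH 2 fun x => a * f x := by
  refine memH_two_iff.2 ⟨hf.continuous.const_mul a, hf.memLp.const_mul a, ?_⟩
  refine (memLp_congr_ae ?_).1 (hf.weight.const_mul a)
  filter_upwards [l2Fourier_const_mul hf.memLp a] with ξ h
  rw [h]; ring

lemma MemH.add {f g : ℝ → ℂ} (hf : MemH 2 f) (hg : MemH 2 g) : MemH 2 fun x => f x + g x := by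
  refine memH_two_iff.2 ⟨hf.continuous.add hg.continuous, hf.memLp.add hg.memLp, ?_⟩
  refine (memLp_congr_ae ?_).1 (hf.weight.add hg.weight)
  filter_upwards [l2Fourier_add hf.memLp hg.memLp] with ξ h
  simp only [Pi.add_apply]
  rw [h]; ring

lemma MemH.comp_add {f : ℝ → ℂ} (hf : MemH 2 f) (a : ℝ) : MemH 2 fun x => f (x + a) := by
  refine memH_two_iff.2 ⟨hf.continuous.comp (by fun_prop), memLp_comp_add hf.memLp a, ?_⟩
  refine (memLp_congr_ae ?_).1 (memLp_expChar_mul hf.weight a)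
  filter_upwards [l2Fourier_comp_add hf.memLp a] with ξ h
  rw [h]; ring

/-! ### Products in `H²` -/

lemma eLpNorm_l2Fourier {f : ℝ → ℂ} (hf : MemLp f 2 (volume : Measure ℝ)) :
    eLpNorm (l2Fourier f) 2 volume = eLpNorm f 2 volume := by
  rw [← Lp.enorm_def, l2Fourier_of_memLp hf, ← Lp.enorm_toLp (hf := hf), ← ofReal_norm,
    ← ofReal_norm, Lp.norm_fourier_eq]

/-- Square-integrable functions which are Lipschitz under translation in the mean. -/
def L2Lipschitz (f : ℝ → ℂ) : Prop :=
  MemLp f 2 (volume : Measure ℝ) ∧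
    ∃ C : ℝ, ∀ h : ℝ, eLpNorm (fun x => f (x + h) - f x) 2 volume ≤ ENNReal.ofReal (C * |h|)

lemma memLp_sub_translate {f : ℝ → ℂ} (hf : MemLp f 2 (volume : Measure ℝ)) (h : ℝ) :
    MemLp (fun x => f (x + h) - f x) 2 (volume : Measure ℝ) :=
  (memLp_comp_add hf h).sub hf

lemma l2Fourier_sub_translate {f : ℝ → ℂ} (hf : MemLp f 2 (volume : Measure ℝ)) (h : ℝ) :
    l2Fourier (fun x => f (x + h) - f x) =ᵐ[volume] fun ξ => (expChar h ξ - 1) * l2Fourier f ξ := by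
  have h1 := l2Fourier_add (memLp_comp_add hf h) (hf.const_mul (-1))
  have e : (fun x => f (x + h) + -1 * f x) = fun x => f (x + h) - f x := by
    ext x; ring
  rw [e] at h1
  filter_upwards [h1, l2Fourier_comp_add hf h, l2Fourier_const_mul hf (-1)] with ξ a1 a2 a3
  rw [a1, a2, a3]; ring

lemma norm_expChar_sub_one_le (h ξ : ℝ) : ‖expChar h ξ - 1‖ ≤ 2 * Real.pi * |h| * |ξ| := by
  have := Real.norm_exp_I_mul_ofReal_sub_one_le (x := 2 * Real.pi * h * ξ)
  rw [expChar, show (2 * Real.pi * Complex.I * h * ξ : ℂ)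
    = Complex.I * ((2 * Real.pi * h * ξ : ℝ) : ℂ) by push_cast; ring]
  refine this.trans_eq ?_
  rw [Real.norm_eq_abs, abs_mul, abs_mul, abs_of_nonneg Real.two_pi_pos.le]

/-- Plancherel applied to `|e^{2πihξ} - 1| ≤ 2π|h||ξ|`. -/
lemma l2Lipschitz_of_memLp_mul {f : ℝ → ℂ} (hf : MemLp f 2 (volume : Measure ℝ))
    (h : MemLp (fun ξ : ℝ => (ξ : ℂ) * l2Fourier f ξ) 2 (volume : Measure ℝ)) : L2Lipschitz f := by
  refine ⟨hf, 2 * Real.pi * (eLpNorm (fun ξ : ℝ => (ξ : ℂ) * l2Fourier f ξ) 2 volume).toReal,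
    fun t => ?_⟩
  rw [← eLpNorm_l2Fourier (memLp_sub_translate hf t),
    eLpNorm_congr_ae (l2Fourier_sub_translate hf t)]
  refine (eLpNorm_le_mul_eLpNorm_of_ae_le_mul (c := 2 * Real.pi * |t|)
    (g := fun ξ : ℝ => (ξ : ℂ) * l2Fourier f ξ) (ae_of_all _ fun ξ => ?_) 2).trans_eq ?_
  · rw [norm_mul, norm_mul, Complex.norm_real, Real.norm_eq_abs, ← mul_assoc]
    gcongr
    exact norm_expChar_sub_one_le t ξ
  · rw [show ∀ a : ℝ, 2 * Real.pi * a * |t| = 2 * Real.pi * |t| * a by intro a; ring,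
      ENNReal.ofReal_mul (p := 2 * Real.pi * |t|) (by positivity), ENNReal.ofReal_toReal h.2.ne]

/-- Fatou's lemma for the Fourier transforms of the difference quotients with step `1/(n+1)`: they
are bounded in `L²` by the Lipschitz constant and converge pointwise to `2πiξ` times the transform
of `f`. With its converse `l2Lipschitz_of_memLp_mul`, this describes one derivative in `L²` by
translations, a condition that passes to products without convolutions. -/
lemma L2Lipschitz.memLp_mul {f : ℝ → ℂ} (hf : L2Lipschitz f) :
    MemLp (fun ξ : ℝ => (ξ : ℂ) * l2Fourier f ξ) 2 (volume : Measure ℝ) := by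
  obtain ⟨hf, C, hC⟩ := hf
  set F : ℕ → ℝ → ℂ := fun n ξ =>
    ((n : ℂ) + 1) * ((expChar (1 / ((n : ℝ) + 1)) ξ - 1) * l2Fourier f ξ) with hF
  have hmeas : ∀ n, AEStronglyMeasurable (F n) volume := fun n =>
    ((((contDiff_expChar _).continuous.sub continuous_const).aestronglyMeasurable).mul
      (memLp_l2Fourier f).1).const_mul _
  have hlim : ∀ ξ, Tendsto (fun n => F n ξ) atTop
      (𝓝 (2 * Real.pi * Complex.I * ξ * l2Fourier f ξ)) := by
    intro ξ
    have hd : HasDerivAt (fun t : ℝ => expChar t ξ) (2 * Real.pi * Complex.I * ξ) 0 := by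
      have h1 : HasDerivAt (fun t : ℝ => (t : ℂ)) 1 0 := Complex.ofRealCLM.hasDerivAt
      have h2 := ((h1.const_mul (2 * Real.pi * Complex.I)).mul_const (ξ : ℂ)).cexp
      simpa [expChar] using h2
    have h3 := (hasDerivAt_iff_tendsto_slope_zero.1 hd).comp
      (tendsto_nhdsWithin_iff.2 ⟨tendsto_one_div_add_atTop_nhds_zero_nat (𝕜 := ℝ),
        Eventually.of_forall fun n => by
          simp only [Set.mem_compl_iff, Set.mem_singleton_iff]; positivity⟩)
    refine (h3.mul_const (l2Fourier f ξ)).congr fun n => ?_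
    simp only [Function.comp, hF, zero_add, Complex.real_smul]
    have : expChar 0 ξ = 1 := by simp [expChar]
    rw [this]
    push_cast
    rw [one_div, inv_inv]
    ring
  have hbound : ∀ n, eLpNorm (F n) 2 volume ≤ ENNReal.ofReal C := by
    intro n
    have e : F n = (((n : ℂ) + 1) • fun ξ =>
      (expChar (1 / ((n : ℝ) + 1)) ξ - 1) * l2Fourier f ξ) := rfl
    rw [e, eLpNorm_const_smul, ← eLpNorm_congr_ae (l2Fourier_sub_translate hf _),
      eLpNorm_l2Fourier (memLp_sub_translate hf _)]
    refine (mul_le_mul_right (hC _) _).trans_eq ?_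
    have hn : (0 : ℝ) < n + 1 := by positivity
    have e2 : ‖(n : ℂ) + 1‖ₑ = ENNReal.ofReal (n + 1) := by
      rw [← ofReal_norm]
      congr 1
      rw [show (n : ℂ) + 1 = ((n + 1 : ℝ) : ℂ) by push_cast; rfl, Complex.norm_real,
        Real.norm_of_nonneg hn.le]
    rw [e2, ← ENNReal.ofReal_mul hn.le, abs_of_pos (by positivity)]
    congr 1
    field_simp
  have h := Lp.eLpNorm_lim_le_liminf_eLpNorm (p := 2) hmeas _ (ae_of_all _ hlim)
  have h2 : eLpNorm (fun ξ : ℝ => 2 * Real.pi * Complex.I * ξ * l2Fourier f ξ) 2 volume < ⊤ := by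
    refine (h.trans ?_).trans_lt (ENNReal.ofReal_lt_top (r := C))
    refine (liminf_le_liminf (v := fun _ => ENNReal.ofReal C)
      (Eventually.of_forall hbound)).trans_eq ?_
    simp
  have h3 : MemLp (fun ξ : ℝ => 2 * Real.pi * Complex.I * ξ * l2Fourier f ξ) 2
      (volume : Measure ℝ) :=
    ⟨((continuous_const.mul Complex.continuous_ofReal).aestronglyMeasurable).mul
      (memLp_l2Fourier f).1, h2⟩
  refine (memLp_congr_ae (ae_of_all _ fun ξ => ?_)).1 (h3.const_mul (2 * Real.pi * Complex.I)⁻¹)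
  have : (2 * Real.pi * Complex.I : ℂ) ≠ 0 := Complex.two_pi_I_ne_zero
  field_simp

lemma L2Lipschitz.add {f g : ℝ → ℂ} (hf : L2Lipschitz f) (hg : L2Lipschitz g) :
    L2Lipschitz fun x => f x + g x := by
  obtain ⟨hf, C, hC⟩ := hf
  obtain ⟨hg, D, hD⟩ := hg
  refine ⟨hf.add hg, |C| + |D|, fun h => ?_⟩
  have e : (fun x => f (x + h) + g (x + h) - (f x + g x))
      = (fun x => f (x + h) - f x) + fun x => g (x + h) - g x := by
    ext x; simp only [Pi.add_apply]; ring
  rw [e, add_mul, ENNReal.ofReal_add (by positivity) (by positivity)]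
  refine (eLpNorm_add_le (memLp_sub_translate hf h).1 (memLp_sub_translate hg h).1
    (by norm_num)).trans (add_le_add ((hC h).trans ?_) ((hD h).trans ?_)) <;>
  · apply ENNReal.ofReal_le_ofReal
    gcongr
    exact le_abs_self _

lemma L2Lipschitz.mul {f g : ℝ → ℂ} (hf : L2Lipschitz f) (hg : L2Lipschitz g)
    {A B : ℝ} (hA : ∀ x, ‖f x‖ ≤ A) (hB : ∀ x, ‖g x‖ ≤ B) :
    L2Lipschitz fun x => f x * g x := by
  obtain ⟨hf, C, hC⟩ := hf
  obtain ⟨hg, D, hD⟩ := hg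
  refine ⟨memLp_bdd_mul hg hf.1 hA, |A| * |D| + |B| * |C|, fun h => ?_⟩
  have e : (fun x => f (x + h) * g (x + h) - f x * g x)
      = (fun x => f (x + h) * (g (x + h) - g x)) + fun x => g x * (f (x + h) - f x) := by
    ext x; simp only [Pi.add_apply]; ring
  rw [e, add_mul, ENNReal.ofReal_add (by positivity) (by positivity)]
  have m1 := memLp_sub_translate hf h
  have m2 := memLp_sub_translate hg h
  refine (eLpNorm_add_le ((memLp_comp_add hf h).1.mul m2.1) (hg.1.mul m1.1)
    (by norm_num)).trans (add_le_add ?_ ?_)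
  · refine (eLpNorm_le_mul_eLpNorm_of_ae_le_mul (c := |A|) (g := fun x => g (x + h) - g x)
      (ae_of_all _ fun x => ?_) 2).trans ?_
    · refine (norm_mul_le _ _).trans ?_
      gcongr
      exact (hA _).trans (le_abs_self _)
    · rw [mul_assoc, ENNReal.ofReal_mul (p := |A|) (by positivity)]
      refine mul_le_mul_right ((hD h).trans (ENNReal.ofReal_le_ofReal ?_)) _
      gcongr; exact le_abs_self _
  · refine (eLpNorm_le_mul_eLpNorm_of_ae_le_mul (c := |B|) (g := fun x => f (x + h) - f x)
      (ae_of_all _ fun x => ?_) 2).trans ?_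
    · refine (norm_mul_le _ _).trans ?_
      gcongr
      exact (hB _).trans (le_abs_self _)
    · rw [mul_assoc, ENNReal.ofReal_mul (p := |B|) (by positivity)]
      refine mul_le_mul_right ((hC h).trans (ENNReal.ofReal_le_ofReal ?_)) _
      gcongr; exact le_abs_self _

lemma MemH.l2Lipschitz {f : ℝ → ℂ} (hf : MemH 2 f) : L2Lipschitz f :=
  l2Lipschitz_of_memLp_mul hf.memLp (memLp_mul_of_weight hf.weight)

lemma MemH.l2Lipschitz_deriv {f : ℝ → ℂ} (hf : MemH 2 f) : L2Lipschitz (deriv f) := by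
  refine l2Lipschitz_of_memLp_mul hf.memLp_deriv ?_
  have h : MemLp (fun ξ : ℝ => (ξ : ℂ) ^ 2 * l2Fourier f ξ) 2 (volume : Measure ℝ) :=
    (memLp_congr_ae (ae_of_all _ fun ξ => by simp only [Pi.sub_apply]; ring)).1
      (hf.weight.sub (memLp_l2Fourier f))
  refine (memLp_congr_ae ?_).1 (h.const_mul (2 * Real.pi * Complex.I))
  filter_upwards [hf.l2Fourier_deriv] with ξ hξ
  rw [hξ]; ring

/-- The transform of `f'` is `2πiξ` times that of `f`, so the `ξ²` part of the weight is `ξ/(2πi)`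
applied to the transform of `f'`, which is square-integrable because `f'` is itself
translation-Lipschitz. -/
lemma memH_two_of_deriv {f f' : ℝ → ℂ} (hf : L2Lipschitz f) (hf' : L2Lipschitz f')
    (hd : ∀ x, HasDerivAt f (f' x) x) : MemH 2 f := by
  refine memH_two_iff.2 ⟨continuous_iff_continuousAt.2 fun x => (hd x).continuousAt, hf.1, ?_⟩
  refine (memLp_congr_ae ?_).1
    ((memLp_l2Fourier f).add (hf'.memLp_mul.const_mul (2 * Real.pi * Complex.I)⁻¹))
  filter_upwards [l2Fourier_of_hasDerivAt hf.1 hf'.1 hd] with ξ hξ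
  simp only [Pi.add_apply]
  rw [hξ]
  have : (2 * Real.pi * Complex.I : ℂ) ≠ 0 := Complex.two_pi_I_ne_zero
  field_simp

/-- `H²(ℝ)` is closed under products. -/
lemma MemH.mul {f g : ℝ → ℂ} (hf : MemH 2 f) (hg : MemH 2 g) : MemH 2 fun x => f x * g x := by
  obtain ⟨A, hA⟩ := hf.bounded
  obtain ⟨B, hB⟩ := hg.bounded
  obtain ⟨A', hA'⟩ := hf.bounded_deriv
  obtain ⟨B', hB'⟩ := hg.bounded_deriv
  exact memH_two_of_deriv (hf.l2Lipschitz.mul hg.l2Lipschitz hA hB)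
    ((hf.l2Lipschitz_deriv.mul hg.l2Lipschitz hA' hB).add
      (hf.l2Lipschitz.mul hg.l2Lipschitz_deriv hA hB'))
    fun x => (hf.hasDerivAt x).mul (hg.hasDerivAt x)

lemma MemH.pow {f : ℝ → ℂ} (hf : MemH 2 f) (n : ℕ) : MemH 2 fun x => f x ^ (n + 1) := by
  induction n with
  | zero => simpa using hf
  | succ n ih => simpa only [pow_succ _ (n + 1)] using ih.mul hf

/-! ### Fourier multipliers -/

lemma contRep_ae_eq (f : ℝ → ℂ) : contRep f =ᵐ[volume] f := by
  unfold contRep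
  split_ifs with h
  · exact h.choose_spec.2
  · rfl

/-- Continuous representatives are unique, so the arbitrary choice in `contRep` is harmless and
multiplier identities for such functions hold at every point. -/
lemma contRep_eq {f k : ℝ → ℂ} (hk : Continuous k) (h : k =ᵐ[volume] f) : contRep f = k := by
  have hex : ∃ k : ℝ → ℂ, Continuous k ∧ k =ᵐ[volume] f := ⟨k, hk, h⟩
  rw [contRep, dif_pos hex]
  exact eq_of_ae_eq_of_continuous hex.choose_spec.1 hk (hex.choose_spec.2.trans h.symm)

lemma fourierMultiplier_spec {m f : ℝ → ℂ} (hf : MemLp f 2 (volume : Measure ℝ))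
    (hm : MemLp (fun ξ => m ξ * l2Fourier f ξ) 2 (volume : Measure ℝ)) :
    MemLp (fourierMultiplier m f) 2 (volume : Measure ℝ) ∧
      l2Fourier (fourierMultiplier m f) =ᵐ[volume] fun ξ => m ξ * l2Fourier f ξ := by
  rw [fourierMultiplier, dif_pos ⟨hf, hm⟩, l2Fourier_congr (contRep_ae_eq _)]
  exact ⟨(memLp_congr_ae (contRep_ae_eq _)).2 (Lp.memLp _), l2Fourier_fourierInv_toLp hm⟩

/-- A continuous function with the right Fourier transform is the value of the multiplier. -/
lemma fourierMultiplier_eq {m f k : ℝ → ℂ} (hf : MemLp f 2 (volume : Measure ℝ))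
    (hm : MemLp (fun ξ => m ξ * l2Fourier f ξ) 2 (volume : Measure ℝ))
    (hk : Continuous k) (hk2 : MemLp k 2 (volume : Measure ℝ))
    (h : l2Fourier k =ᵐ[volume] fun ξ => m ξ * l2Fourier f ξ) :
    fourierMultiplier m f = k := by
  rw [fourierMultiplier, dif_pos ⟨hf, hm⟩]
  refine contRep_eq hk (ae_eq_of_l2Fourier_ae_eq hk2 (Lp.memLp _) ?_)
  exact h.trans (l2Fourier_fourierInv_toLp hm).symm

/-- A bounded symbol commutes with the weight. The weighted bound also makes the new transform
integrable, so its inversion integral is the continuous representative that is selected. -/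
lemma MemH.fourierMultiplier {m f : ℝ → ℂ} (hf : MemH 2 f) (hm : AEStronglyMeasurable m volume)
    {C : ℝ} (hC : ∀ ξ, ‖m ξ‖ ≤ C) : MemH 2 (fourierMultiplier m f) := by
  have hw : MemLp (fun ξ : ℝ => (1 + (ξ : ℂ) ^ 2) * (m ξ * l2Fourier f ξ)) 2
      (volume : Measure ℝ) :=
    (memLp_congr_ae (ae_of_all _ fun ξ => by ring)).1 (memLp_bdd_mul hf.weight hm hC)
  have h2 := memLp_of_weight hw
  have h1 := integrable_of_weight hw
  obtain ⟨k1, k2⟩ := l2Fourier_fourierInv h2 h1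
  rw [fourierMultiplier_eq hf.memLp h2 (continuous_fourierInv h1) k1 k2]
  refine memH_two_iff.2 ⟨continuous_fourierInv h1, k1, (memLp_congr_ae ?_).1 hw⟩
  filter_upwards [k2] with ξ h
  rw [h]

/-! ### Boundary values of holomorphic functions in the lower half-plane -/

/-- `F` is continuous and bounded on the closed lower half-plane, and holomorphic inside. -/
structure LowerHolomorphic (F : ℂ → ℂ) : Prop where
  continuousOn : ContinuousOn F {z | z.im ≤ 0}
  differentiableOn : DifferentiableOn ℂ F {z | z.im < 0}
  bounded : ∃ C, ∀ z : ℂ, z.im ≤ 0 → ‖F z‖ ≤ C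

/-- `f` is the boundary value of a bounded holomorphic function in the lower half-plane. -/
def LowerTrace (f : ℝ → ℂ) : Prop := ∃ F, LowerHolomorphic F ∧ ∀ x : ℝ, F x = f x

namespace LowerHolomorphic

variable {F G : ℂ → ℂ}

lemma const (a : ℂ) : LowerHolomorphic fun _ => a :=
  ⟨continuousOn_const, differentiableOn_const a, ‖a‖, fun _ _ => le_rfl⟩

lemma add (hF : LowerHolomorphic F) (hG : LowerHolomorphic G) :
    LowerHolomorphic fun z => F z + G z := by
  obtain ⟨A, hA⟩ := hF.bounded
  obtain ⟨B, hB⟩ := hG.bounded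
  exact ⟨hF.continuousOn.add hG.continuousOn, hF.differentiableOn.add hG.differentiableOn, A + B,
    fun z hz => (norm_add_le _ _).trans (add_le_add (hA z hz) (hB z hz))⟩

lemma mul (hF : LowerHolomorphic F) (hG : LowerHolomorphic G) :
    LowerHolomorphic fun z => F z * G z := by
  obtain ⟨A, hA⟩ := hF.bounded
  obtain ⟨B, hB⟩ := hG.bounded
  exact ⟨hF.continuousOn.mul hG.continuousOn, hF.differentiableOn.mul hG.differentiableOn, A * B,
    fun z hz => (norm_mul_le _ _).trans (mul_le_mul (hA z hz) (hB z hz) (norm_nonneg _)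
      ((norm_nonneg _).trans (hA z hz)))⟩

/-- A uniform lower bound is required, not just nonvanishing, because the inverse has to stay
bounded. -/
lemma inv (hF : LowerHolomorphic F) {δ : ℝ} (hδ : 0 < δ)
    (h : ∀ z : ℂ, z.im ≤ 0 → δ ≤ ‖F z‖) : LowerHolomorphic fun z => (F z)⁻¹ := by
  have h0 : ∀ z : ℂ, z.im ≤ 0 → F z ≠ 0 := fun z hz => norm_pos_iff.1 (hδ.trans_le (h z hz))
  refine ⟨hF.continuousOn.inv₀ h0, hF.differentiableOn.inv fun z hz => h0 z (le_of_lt hz), δ⁻¹,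
    fun z hz => ?_⟩
  rw [norm_inv]
  exact inv_anti₀ hδ (h z hz)

end LowerHolomorphic

namespace LowerTrace

variable {f g : ℝ → ℂ}

lemma const (a : ℂ) : LowerTrace fun _ => a := ⟨_, .const a, fun _ => rfl⟩

lemma add (hf : LowerTrace f) (hg : LowerTrace g) : LowerTrace fun x => f x + g x := by
  obtain ⟨F, hF, hF'⟩ := hf
  obtain ⟨G, hG, hG'⟩ := hg
  exact ⟨_, hF.add hG, fun x => by simp only [hF', hG']⟩

lemma mul (hf : LowerTrace f) (hg : LowerTrace g) : LowerTrace fun x => f x * g x := by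
  obtain ⟨F, hF, hF'⟩ := hf
  obtain ⟨G, hG, hG'⟩ := hg
  exact ⟨_, hF.mul hG, fun x => by simp only [hF', hG']⟩

lemma const_mul (a : ℂ) (hf : LowerTrace f) : LowerTrace fun x => a * f x := (const a).mul hf

lemma continuous (hf : LowerTrace f) : Continuous f := by
  obtain ⟨F, hF, hF'⟩ := hf
  have : f = fun x : ℝ => F x := funext fun x => (hF' x).symm
  rw [this]
  exact hF.continuousOn.comp_continuous Complex.continuous_ofReal fun x => by simp

lemma bounded (hf : LowerTrace f) : ∃ C, ∀ x, ‖f x‖ ≤ C := by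
  obtain ⟨F, hF, hF'⟩ := hf
  obtain ⟨C, hC⟩ := hF.bounded
  exact ⟨C, fun x => hF' x ▸ hC x (by simp)⟩

lemma memLp_mul (hf : LowerTrace f) (hg : MemLp g 2 (volume : Measure ℝ)) :
    MemLp (fun x => f x * g x) 2 (volume : Measure ℝ) := by
  obtain ⟨C, hC⟩ := hf.bounded
  exact memLp_bdd_mul hg hf.continuous.aestronglyMeasurable hC

end LowerTrace

/-- Cauchy's theorem in the lower half-plane. -/
lemma integral_eq_zero_of_holomorphic {G : ℂ → ℂ} (hc : ContinuousOn G {z | z.im ≤ 0})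
    (hd : DifferentiableOn ℂ G {z | z.im < 0}) {M : ℝ}
    (hM : ∀ z : ℂ, z.im ≤ 0 → ‖G z‖ * ‖z‖ ^ 2 ≤ M) (hi : Integrable fun x : ℝ => G x) :
    ∫ x : ℝ, G x = 0 := by
  have hlim := intervalIntegral_tendsto_integral hi tendsto_neg_atTop_atBot
    (tendsto_id (α := ℝ) (x := atTop))
  -- Cauchy's theorem is applied on the rectangle with real side `[-R, R]` and depth `R`. The three
  -- other sides lie in `|z| ≥ R`, where `|G| ≤ M/R²`, and their total length is `4R`; hence the
  -- bound `4M/R`.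
  refine tendsto_nhds_unique hlim (squeeze_zero_norm' (a := fun R : ℝ => 4 * M / R) ?_
    (tendsto_const_nhds.div_atTop tendsto_id))
  filter_upwards [eventually_gt_atTop (0 : ℝ)] with R hR
  have hrect := Complex.integral_boundary_rect_eq_zero_of_continuousOn_of_differentiableOn G
    (⟨-R, -R⟩ : ℂ) (⟨R, 0⟩ : ℂ)
    (hc.mono fun z hz => by
      have := hz.2
      simp only [Set.mem_preimage, Set.uIcc_of_le (neg_nonpos.2 hR.le), Set.mem_Icc] at this
      exact this.2)
    (hd.mono fun z hz => by
      have := hz.2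
      simp only [Set.mem_preimage, Set.mem_Ioo, max_eq_right (neg_nonpos.2 hR.le)] at this
      exact this.2)
  simp only [Complex.ofReal_zero, zero_mul, add_zero, smul_eq_mul, Complex.ofReal_neg] at hrect
  have hb : ∀ z : ℂ, z.im ≤ 0 → R ≤ ‖z‖ → ‖G z‖ ≤ M / R ^ 2 := by
    intro z hz hRz
    rw [le_div_iff₀ (by positivity)]
    refine le_trans ?_ (hM z hz)
    gcongr
  have h1 : ‖∫ x : ℝ in -R..R, G (x + -R * Complex.I)‖ ≤ M / R ^ 2 * |R - -R| := by
    refine intervalIntegral.norm_integral_le_of_norm_le_const fun x _ => hb _ ?_ ?_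
    · simp [hR.le]
    · refine le_trans ?_ (Complex.abs_im_le_norm _)
      simp [abs_of_pos hR]
  have h2 : ∀ s : ℝ, |s| = R →
      ‖∫ y : ℝ in -R..0, G (s + y * Complex.I)‖ ≤ M / R ^ 2 * |0 - -R| := by
    intro s hs
    refine intervalIntegral.norm_integral_le_of_norm_le_const fun y hy => hb _ ?_ ?_
    · rw [Set.uIoc_of_le (neg_nonpos.2 hR.le)] at hy
      simpa using hy.2
    · refine le_trans ?_ (Complex.abs_re_le_norm _)
      simp [hs]
  have h3 := h2 R (abs_of_pos hR)
  have h4 := h2 (-R) (by rw [abs_neg, abs_of_pos hR])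
  have e : ∫ x : ℝ in -R..R, G x = (∫ x : ℝ in -R..R, G (x + -R * Complex.I))
      + Complex.I * (∫ y : ℝ in -R..0, G (R + y * Complex.I))
      - Complex.I * (∫ y : ℝ in -R..0, G (((-R : ℝ) : ℂ) + y * Complex.I)) := by
    rw [Complex.ofReal_neg]
    linear_combination -hrect
  simp only [id]
  rw [e]
  refine ((norm_sub_le _ _).trans (add_le_add_left (norm_add_le _ _) _)).trans ?_
  rw [norm_mul, norm_mul, Complex.norm_I, one_mul, one_mul]
  refine (add_le_add (add_le_add h1 h3) h4).trans_eq ?_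
  rw [show |R - -R| = 2 * R by rw [abs_of_pos] <;> linarith,
    show |0 - -R| = R by rw [abs_of_pos] <;> linarith]
  field_simp
  ring

/-- The zero of `1 + iεz` lies in the upper half-plane (for `ε > 0`). Dividing by its square thus
keeps a function holomorphic below, gives decay of order `|z|⁻²`, and never increases the modulus.
-/
lemma norm_regularizer_sq {ε : ℝ} (hε : 0 ≤ ε) {z : ℂ} (hz : z.im ≤ 0) :
    1 + ε ^ 2 * ‖z‖ ^ 2 ≤ ‖1 + Complex.I * ε * z‖ ^ 2 := by
  rw [← Complex.normSq_eq_norm_sq, ← Complex.normSq_eq_norm_sq, Complex.normSq_apply,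
    Complex.normSq_apply]
  simp
  nlinarith [mul_nonneg hε (neg_nonneg.2 hz)]

/-- The Fourier transform vanishes at positive frequencies. -/
def NegFreq (f : ℝ → ℂ) : Prop := ∀ᵐ ξ : ℝ, 0 < ξ → l2Fourier f ξ = 0

/-- For `ξ ≥ 0` the kernel `e^{-2πiξz}` has modulus at most one in the lower half-plane, so the
regularized integrand satisfies the decay needed for `integral_eq_zero_of_holomorphic`. -/
lemma fourier_regularized_eq_zero {F : ℂ → ℂ} (hF : LowerHolomorphic F) {ε : ℝ} (hε : 0 < ε) :
    Integrable (fun x : ℝ => F x / (1 + Complex.I * ε * x) ^ 2) ∧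
    ∀ ξ : ℝ, 0 ≤ ξ → 𝓕 (fun x : ℝ => F x / (1 + Complex.I * ε * x) ^ 2 : ℝ → ℂ) ξ = 0 := by
  obtain ⟨C, hC⟩ := hF.bounded
  have hC0 : 0 ≤ C := (norm_nonneg _).trans (hC 0 (by simp))
  have hne : ∀ z : ℂ, z.im ≤ 0 → (1 + Complex.I * ε * z) ^ 2 ≠ 0 := by
    intro z hz
    rw [← norm_pos_iff, norm_pow]
    exact lt_of_lt_of_le (by positivity) (norm_regularizer_sq hε.le hz)
  have hcont : ContinuousOn (fun z => F z / (1 + Complex.I * ε * z) ^ 2) {z | z.im ≤ 0} :=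
    hF.continuousOn.div (by fun_prop) fun z hz => hne z hz
  have hcr : Continuous fun x : ℝ => F x / (1 + Complex.I * ε * x) ^ 2 :=
    hcont.comp_continuous Complex.continuous_ofReal fun x => by simp
  have hint : Integrable fun x : ℝ => F x / (1 + Complex.I * ε * x) ^ 2 := by
    refine ((integrable_inv_one_add_sq.comp_mul_left' hε.ne').const_mul C).mono'
      hcr.aestronglyMeasurable (ae_of_all _ fun x => ?_)
    rw [norm_div, norm_pow, div_eq_mul_inv]
    have h := norm_regularizer_sq hε.le (z := x) (by simp)
    rw [Complex.norm_real, Real.norm_eq_abs, sq_abs, ← mul_pow] at h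
    exact mul_le_mul (hC _ (by simp)) (inv_anti₀ (by positivity) h) (by positivity) hC0
  refine ⟨hint, fun ξ hξ => ?_⟩
  rw [Real.fourier_real_eq_integral_exp_smul]
  set G : ℂ → ℂ := fun z =>
    Complex.exp (-2 * Real.pi * Complex.I * ξ * z) * (F z / (1 + Complex.I * ε * z) ^ 2) with hG
  have he : ∀ z : ℂ, z.im ≤ 0 → ‖Complex.exp (-2 * Real.pi * Complex.I * ξ * z)‖ ≤ 1 := by
    intro z hz
    rw [Complex.norm_exp, Real.exp_le_one_iff]
    have : (-2 * Real.pi * Complex.I * ξ * z : ℂ).re = 2 * Real.pi * ξ * z.im := by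
      simp [Complex.mul_re, Complex.mul_im]
    rw [this]
    exact mul_nonpos_of_nonneg_of_nonpos (by positivity) hz
  have hGr : ∀ x : ℝ, Complex.exp (((-2 * Real.pi * x * ξ : ℝ) : ℂ) * Complex.I) •
      (F x / (1 + Complex.I * ε * x) ^ 2) = G x := by
    intro x
    simp only [hG, smul_eq_mul]
    congr 2
    push_cast
    ring
  simp only [hGr]
  refine integral_eq_zero_of_holomorphic (M := C / ε ^ 2) ?_ ?_ ?_ ?_
  · exact ContinuousOn.mul (by fun_prop) hcont
  · refine DifferentiableOn.mul (by fun_prop) (hF.differentiableOn.div (by fun_prop)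
      fun z hz => hne z (le_of_lt hz))
  · intro z hz
    simp only [hG, norm_mul, norm_div, norm_pow]
    have h := norm_regularizer_sq hε.le hz
    have h1 : ε ^ 2 * ‖z‖ ^ 2 ≤ ‖1 + Complex.I * ε * z‖ ^ 2 := by linarith
    have h0 : 0 < ‖1 + Complex.I * ε * z‖ ^ 2 := lt_of_lt_of_le (by positivity) h
    calc _ ≤ 1 * (C / ‖1 + Complex.I * ε * z‖ ^ 2) * ‖z‖ ^ 2 := by
          gcongr
          · exact he z hz
          · exact hC z hz
      _ ≤ C / ε ^ 2 := by
          rw [one_mul, div_mul_eq_mul_div, div_le_div_iff₀ h0 (by positivity)]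
          nlinarith
  · refine (hint.mono ?_ (ae_of_all _ fun x => ?_))
    · simp only [← hGr]
      have hce : Continuous fun x : ℝ =>
        Complex.exp (((-2 * Real.pi * x * ξ : ℝ) : ℂ) * Complex.I) := by fun_prop
      exact (hce.smul hcr).aestronglyMeasurable
    · simp only [hG, norm_mul]
      exact mul_le_of_le_one_left (norm_nonneg _) (he x (by simp))

/-- Square-integrable boundary values of bounded holomorphic functions in the lower half-plane
have only negative frequencies. -/
lemma LowerTrace.negFreq {f : ℝ → ℂ} (hf : LowerTrace f) (h2 : MemLp f 2 (volume : Measure ℝ)) :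
    NegFreq f := by
  obtain ⟨F, hF, hFf⟩ := hf
  refine isOpen_Ioi.ae_eq_zero_of_integral_contDiff_smul_eq_zero
    ((memLp_l2Fourier f).locallyIntegrable_two.locallyIntegrableOn _) fun k h₁ h₂ h₃ => ?_
  have h := integral_mul_l2Fourier h2 (testFun h₁ h₂)
  have e : ∫ x, k x • l2Fourier f x = ∫ x, testFun h₁ h₂ x * l2Fourier f x := by simp
  rw [e, h]
  set H : ℕ → ℝ → ℂ := fun n x => F x / (1 + Complex.I * (1 / ((n : ℝ) + 1) : ℝ) * x) ^ 2 with hH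
  have hpos : ∀ n : ℕ, (0 : ℝ) < 1 / ((n : ℝ) + 1) := fun n => by positivity
  have hzero : ∀ n, ∫ x, 𝓕 (testFun h₁ h₂ : ℝ → ℂ) x * H n x = 0 := by
    intro n
    obtain ⟨hi, hz⟩ := fourier_regularized_eq_zero hF (hpos n)
    rw [integral_fourier_mul (testFun h₁ h₂).integrable hi]
    refine integral_eq_zero_of_ae (ae_of_all _ fun ξ => ?_)
    by_cases hξ : 0 < ξ
    · simp only [hz ξ hξ.le, mul_zero, Pi.zero_apply]
    · have : k ξ = 0 := image_eq_zero_of_notMem_tsupport fun hmem => hξ (h₃ hmem)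
      simp [this]
  -- The regularization is removed with `ε = 1/(n+1)`. Since the regularizer has modulus at least
  -- one, the unregularized integrand is a dominating function.
  have hlim : Tendsto (fun n => ∫ x, 𝓕 (testFun h₁ h₂ : ℝ → ℂ) x * H n x) atTop
      (𝓝 (∫ x, 𝓕 (testFun h₁ h₂ : ℝ → ℂ) x * f x)) := by
    have hFF : 𝓕 (testFun h₁ h₂ : ℝ → ℂ) = (𝓕 (testFun h₁ h₂) : 𝓢(ℝ, ℂ)) := rfl
    rw [hFF]
    refine tendsto_integral_of_dominated_convergence _ (fun n => ?_)
      (integrable_schwartz_mul h2 (𝓕 (testFun h₁ h₂))).norm (fun n => ae_of_all _ fun x => ?_)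
      (ae_of_all _ fun x => ?_)
    · exact (SchwartzMap.continuous _).aestronglyMeasurable.mul
        (fourier_regularized_eq_zero hF (hpos n)).1.1
    · rw [norm_mul, norm_mul]
      gcongr
      simp only [hH, norm_div, norm_pow, hFf]
      refine div_le_self (norm_nonneg _) ?_
      refine le_trans ?_ (norm_regularizer_sq (hpos n).le (z := x) (by simp))
      nlinarith [mul_nonneg (sq_nonneg (1 / ((n : ℝ) + 1))) (sq_nonneg ‖(x : ℂ)‖)]
    · refine Tendsto.const_mul _ ?_
      have ht : Tendsto (fun n : ℕ => (((1 / ((n : ℝ) + 1) : ℝ)) : ℂ)) atTop (𝓝 ((0 : ℝ) : ℂ)) :=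
        (Complex.continuous_ofReal.tendsto 0).comp (tendsto_one_div_add_atTop_nhds_zero_nat)
      have h3 : Tendsto (fun n => H n x) atTop
          (𝓝 (F x / (1 + Complex.I * ((0 : ℝ) : ℂ) * x) ^ 2)) :=
        tendsto_const_nhds.div ((((ht.const_mul _).mul_const _).const_add _).pow 2) (by simp)
      simpa [hFf] using h3
  simp only [hzero] at hlim
  exact (tendsto_nhds_unique tendsto_const_nhds hlim).symm

/-! ### The Fourier-Laplace integral -/

/-- The Fourier-Laplace integral over the negative frequencies. -/
def halfLaplace (φ : ℝ → ℂ) (z : ℂ) : ℂ :=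
  ∫ ξ in Set.Iio (0 : ℝ), Complex.exp (2 * Real.pi * Complex.I * ξ * z) * φ ξ

lemma lowerExt_eq_halfLaplace (f : ℝ → ℂ) : lowerExt f = halfLaplace (l2Fourier f) := rfl

lemma norm_exp_laplace (ξ : ℝ) (z : ℂ) :
    ‖Complex.exp (2 * Real.pi * Complex.I * ξ * z)‖ = Real.exp (-(2 * Real.pi * ξ * z.im)) := by
  rw [Complex.norm_exp]
  congr 1
  simp [Complex.mul_re, Complex.mul_im]

lemma norm_exp_laplace_le {ξ : ℝ} (hξ : ξ < 0) {z : ℂ} (hz : z.im ≤ 0) :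
    ‖Complex.exp (2 * Real.pi * Complex.I * ξ * z)‖ ≤ 1 := by
  rw [norm_exp_laplace, Real.exp_le_one_iff, neg_nonpos, mul_assoc]
  exact mul_nonneg Real.two_pi_pos.le (mul_nonneg_of_nonpos_of_nonpos hξ.le hz)

lemma aestronglyMeasurable_laplace {φ : ℝ → ℂ} (hφ : IntegrableOn φ (Set.Iio 0)) (z : ℂ) :
    AEStronglyMeasurable (fun ξ : ℝ => Complex.exp (2 * Real.pi * Complex.I * ξ * z) * φ ξ)
      (volume.restrict (Set.Iio 0)) :=
  AEStronglyMeasurable.mul (Continuous.aestronglyMeasurable (by fun_prop)) hφ.1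

lemma norm_laplace_integrand_le (φ : ℝ → ℂ) {z : ℂ} (hz : z.im ≤ 0) :
    ∀ᵐ ξ : ℝ ∂(volume.restrict (Set.Iio 0)),
      ‖Complex.exp (2 * Real.pi * Complex.I * ξ * z) * φ ξ‖ ≤ ‖φ ξ‖ := by
  refine (ae_restrict_iff' measurableSet_Iio).2 (ae_of_all _ fun ξ hξ => ?_)
  rw [norm_mul]
  exact mul_le_of_le_one_left (norm_nonneg _) (norm_exp_laplace_le hξ hz)

lemma continuousOn_halfLaplace {φ : ℝ → ℂ} (hφ : IntegrableOn φ (Set.Iio 0)) :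
    ContinuousOn (halfLaplace φ) {z | z.im ≤ 0} := by
  refine continuousOn_of_dominated (fun z _ => aestronglyMeasurable_laplace hφ z)
    (fun z hz => norm_laplace_integrand_le φ hz) hφ.norm (ae_of_all _ fun ξ => ?_)
  fun_prop

lemma hasDerivAt_halfLaplace {φ : ℝ → ℂ} (hφ : IntegrableOn φ (Set.Iio 0)) {z : ℂ}
    (hz : z.im < 0) :
    HasDerivAt (halfLaplace φ)
      (halfLaplace (fun ξ => 2 * Real.pi * Complex.I * ξ * φ ξ) z) z := by
  -- The ball of radius `r` about `z` stays at depth at least `r`. There the derivative of the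
  -- kernel is at most `s e^{-sr} ≤ 1/r` with `s = 2π|ξ|`, so integrability of `φ` alone suffices,
  -- with no moment condition.
  set r : ℝ := -z.im / 2 with hr
  have hr0 : 0 < r := by rw [hr]; linarith
  have key := hasDerivAt_integral_of_dominated_loc_of_deriv_le
    (μ := volume.restrict (Set.Iio (0 : ℝ)))
    (F := fun (z : ℂ) (ξ : ℝ) => Complex.exp (2 * Real.pi * Complex.I * ξ * z) * φ ξ)
    (F' := fun (z : ℂ) (ξ : ℝ) =>
      Complex.exp (2 * Real.pi * Complex.I * ξ * z) * (2 * Real.pi * Complex.I * ξ * φ ξ))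
    (bound := fun ξ => r⁻¹ * ‖φ ξ‖) (x₀ := z) (s := Metric.ball z r) (Metric.ball_mem_nhds z hr0)
    (Eventually.of_forall fun z => aestronglyMeasurable_laplace hφ z)
    (hφ.norm.mono' (aestronglyMeasurable_laplace hφ z) (norm_laplace_integrand_le φ hz.le))
    (AEStronglyMeasurable.mul (Continuous.aestronglyMeasurable (by fun_prop))
      (AEStronglyMeasurable.mul (Continuous.aestronglyMeasurable (by fun_prop)) hφ.1))
    ((ae_restrict_iff' measurableSet_Iio).2 (ae_of_all _ fun ξ hξ y hy => ?_))
    (hφ.norm.const_mul _) (ae_of_all _ fun ξ y _ => ?_)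
  · exact key.2
  · have him : y.im ≤ -r := by
      have h1 := (Complex.abs_im_le_norm (y - z)).trans_lt (mem_ball_iff_norm.1 hy)
      rw [Complex.sub_im, abs_lt] at h1
      linarith [h1.2]
    have hξ' : ξ < 0 := hξ
    set s : ℝ := 2 * Real.pi * |ξ| with hs
    have hs0 : 0 ≤ s := by positivity
    have e1 : ‖(2 * Real.pi * Complex.I * ξ : ℂ)‖ = s := by
      simp [hs, abs_of_pos Real.pi_pos]
    rw [norm_mul, norm_mul, e1, norm_exp_laplace, ← mul_assoc]
    gcongr
    have h2 : Real.exp (-(2 * Real.pi * ξ * y.im)) ≤ Real.exp (-(s * r)) := by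
      apply Real.exp_le_exp.2
      rw [hs, abs_of_neg hξ']
      nlinarith [mul_pos Real.two_pi_pos (neg_pos.2 hξ')]
    have h3 : s * r * Real.exp (-(s * r)) ≤ 1 := by
      rw [Real.exp_neg, ← div_eq_mul_inv, div_le_one (Real.exp_pos _)]
      linarith [Real.add_one_le_exp (s * r)]
    rw [← one_div, le_div_iff₀ hr0]
    calc _ ≤ Real.exp (-(s * r)) * s * r := by gcongr
      _ ≤ 1 := by linarith
  · have h1 : HasDerivAt (fun z : ℂ => 2 * Real.pi * Complex.I * ξ * z)
        (2 * Real.pi * Complex.I * ξ) y := by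
      simpa using (hasDerivAt_id y).const_mul (2 * Real.pi * Complex.I * ξ : ℂ)
    have h2 := h1.cexp.mul_const (φ ξ)
    simpa [mul_assoc] using h2

lemma norm_halfLaplace_le {φ : ℝ → ℂ} (hφ : IntegrableOn φ (Set.Iio 0)) {z : ℂ} (hz : z.im ≤ 0) :
    ‖halfLaplace φ z‖ ≤ ∫ ξ in Set.Iio (0 : ℝ), ‖φ ξ‖ :=
  norm_integral_le_of_norm_le hφ.norm (norm_laplace_integrand_le φ hz)

lemma lowerHolomorphic_halfLaplace {φ : ℝ → ℂ} (hφ : IntegrableOn φ (Set.Iio 0)) :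
    LowerHolomorphic (halfLaplace φ) :=
  ⟨continuousOn_halfLaplace hφ,
    fun _ hz => (hasDerivAt_halfLaplace hφ hz).differentiableAt.differentiableWithinAt,
    _, fun _ hz => norm_halfLaplace_le hφ hz⟩

lemma tendsto_integral_exp_atBot {φ : ℝ → ℂ} (hφ : IntegrableOn φ (Set.Iio 0)) :
    Tendsto (fun y : ℝ => ∫ ξ in Set.Iio (0 : ℝ), Real.exp (-(2 * Real.pi * ξ * y)) * ‖φ ξ‖)
      atBot (𝓝 0) := by
  have h := tendsto_integral_filter_of_dominated_convergence (l := atBot)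
    (μ := volume.restrict (Set.Iio (0 : ℝ)))
    (F := fun (y : ℝ) ξ => Real.exp (-(2 * Real.pi * ξ * y)) * ‖φ ξ‖) (f := fun _ => (0 : ℝ))
    (fun ξ => ‖φ ξ‖)
    (Eventually.of_forall fun y =>
      AEStronglyMeasurable.mul (Continuous.aestronglyMeasurable (by fun_prop)) hφ.1.norm)
    ?_ hφ.norm ?_
  · simpa using h
  · filter_upwards [eventually_le_atBot (0 : ℝ)] with y hy
    refine (ae_restrict_iff' measurableSet_Iio).2 (ae_of_all _ fun ξ hξ => ?_)
    have hξ' : ξ < 0 := hξ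
    rw [Real.norm_of_nonneg (by positivity)]
    refine mul_le_of_le_one_left (norm_nonneg _) (Real.exp_le_one_iff.2 ?_)
    rw [neg_nonpos, mul_assoc]
    exact mul_nonneg Real.two_pi_pos.le (mul_nonneg_of_nonpos_of_nonpos hξ'.le hy)
  · refine (ae_restrict_iff' measurableSet_Iio).2 (ae_of_all _ fun ξ hξ => ?_)
    have hξ' : ξ < 0 := hξ
    have h1 : Tendsto (fun y : ℝ => -(2 * Real.pi * ξ * y)) atBot atBot := by
      have : 0 < -(2 * Real.pi * ξ) := by nlinarith [Real.two_pi_pos]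
      simpa [neg_mul] using (tendsto_id (α := ℝ) (x := atBot)).const_mul_atBot this
    simpa using (Real.tendsto_exp_atBot.comp h1).mul_const ‖φ ξ‖

/-- The Riemann–Lebesgue lemma: on a horizontal line, `halfLaplace φ` is the Fourier transform,
evaluated at `-x`, of `φ` damped by `e^{2π|t|ξ}` and cut to the negative half-line. Using `-|t|` as
height keeps the statement inside the half-plane for every real `t`, hence on full neighbourhoods of
`t = 0`. -/
lemma tendsto_halfLaplace_horizontal (φ : ℝ → ℂ) (t : ℝ) :
    Tendsto (fun x : ℝ => halfLaplace φ (x + (-|t| : ℝ) * Complex.I)) (cocompact ℝ) (𝓝 0) := by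
  have h := Real.zero_at_infty_fourier (fun ξ : ℝ => (Set.Iio (0 : ℝ)).indicator
    (fun ξ => Complex.exp (2 * Real.pi * |t| * ξ) * φ ξ) ξ)
  have h2 := h.comp (Homeomorph.neg ℝ).isClosedEmbedding.tendsto_cocompact
  refine h2.congr fun x => ?_
  simp only [Function.comp, Homeomorph.coe_neg]
  rw [Real.fourier_real_eq_integral_exp_smul, halfLaplace, ← integral_indicator measurableSet_Iio]
  refine integral_congr_ae (ae_of_all _ fun ξ => ?_)
  by_cases hξ : ξ ∈ Set.Iio (0 : ℝ)
  · simp only [Set.indicator_of_mem hξ, smul_eq_mul, ← mul_assoc, ← Complex.exp_add]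
    congr 2
    push_cast
    linear_combination (2 * Real.pi * ξ * |t| : ℂ) * Complex.I_sq
  · simp only [Set.indicator_of_notMem hξ, smul_zero]

/-- Riemann–Lebesgue holds at the fixed depth `|t₀|`. Changing the depth costs at most `D t`, which
is independent of the horizontal variable, continuous in `t` by dominated convergence, and zero at
`t₀`. The decay is therefore locally uniform in the depth. -/
lemma eventually_norm_halfLaplace_lt {φ : ℝ → ℂ} (hφ : IntegrableOn φ (Set.Iio 0)) {ε : ℝ}
    (hε : 0 < ε) (t₀ : ℝ) :
    ∀ᶠ p : ℝ × ℝ in cocompact ℝ ×ˢ 𝓝 t₀,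
      ‖halfLaplace φ (p.1 + (-|p.2| : ℝ) * Complex.I)‖ < ε := by
  set D : ℝ → ℝ := fun t => ∫ ξ in Set.Iio (0 : ℝ),
    |Real.exp (2 * Real.pi * ξ * |t|) - Real.exp (2 * Real.pi * ξ * |t₀|)| * ‖φ ξ‖ with hD
  have hexp : ∀ t : ℝ, ∀ ξ ∈ Set.Iio (0 : ℝ), Real.exp (2 * Real.pi * ξ * |t|) ≤ 1 := by
    intro t ξ hξ
    have hξ' : ξ < 0 := hξ
    rw [Real.exp_le_one_iff]
    nlinarith [mul_nonneg (mul_nonneg Real.two_pi_pos.le (neg_nonneg.2 hξ'.le)) (abs_nonneg t)]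
  have hDm : ∀ t, AEStronglyMeasurable (fun ξ =>
      |Real.exp (2 * Real.pi * ξ * |t|) - Real.exp (2 * Real.pi * ξ * |t₀|)| * ‖φ ξ‖)
      (volume.restrict (Set.Iio (0 : ℝ))) := fun t =>
    AEStronglyMeasurable.mul (Continuous.aestronglyMeasurable (by fun_prop)) hφ.1.norm
  have hDb : ∀ t, ∀ᵐ ξ ∂(volume.restrict (Set.Iio (0 : ℝ))),
      ‖|Real.exp (2 * Real.pi * ξ * |t|) - Real.exp (2 * Real.pi * ξ * |t₀|)| * ‖φ ξ‖‖
        ≤ ‖φ ξ‖ := by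
    intro t
    refine (ae_restrict_iff' measurableSet_Iio).2 (ae_of_all _ fun ξ hξ => ?_)
    rw [Real.norm_of_nonneg (by positivity)]
    refine mul_le_of_le_one_left (norm_nonneg _) ?_
    rw [abs_le]
    constructor <;>
    linarith [hexp t ξ hξ, hexp t₀ ξ hξ, Real.exp_pos (2 * Real.pi * ξ * |t|),
      Real.exp_pos (2 * Real.pi * ξ * |t₀|)]
  have hDc : Continuous D :=
    continuous_of_dominated hDm hDb hφ.norm (ae_of_all _ fun ξ => by fun_prop)
  have hD0 : D t₀ = 0 := by simp [hD]
  have h1 : ∀ᶠ x : ℝ in cocompact ℝ, ‖halfLaplace φ (x + (-|t₀| : ℝ) * Complex.I)‖ < ε / 2 := by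
    have := (tendsto_halfLaplace_horizontal φ t₀).norm
    rw [norm_zero] at this
    exact this.eventually_lt_const (by positivity)
  have h2 : ∀ᶠ t in 𝓝 t₀, D t < ε / 2 :=
    (hDc.tendsto t₀).eventually_lt_const (by rw [hD0]; positivity)
  filter_upwards [h1.prod_mk h2] with p hp
  obtain ⟨x, t⟩ := p
  have hI : ∀ s : ℝ, Integrable (fun ξ : ℝ =>
      Complex.exp (2 * Real.pi * Complex.I * ξ * (x + (-|s| : ℝ) * Complex.I)) * φ ξ)
      (volume.restrict (Set.Iio (0 : ℝ))) := fun s =>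
    hφ.norm.mono' (aestronglyMeasurable_laplace hφ _) (norm_laplace_integrand_le φ (by simp))
  have h3 : ‖halfLaplace φ (x + (-|t| : ℝ) * Complex.I)
      - halfLaplace φ (x + (-|t₀| : ℝ) * Complex.I)‖ ≤ D t := by
    unfold halfLaplace
    rw [← integral_sub (hI t) (hI t₀)]
    refine norm_integral_le_of_norm_le (hφ.norm.mono' (hDm t) (hDb t)) (ae_of_all _ fun ξ => ?_)
    rw [← sub_mul, norm_mul]
    gcongr
    have e : ∀ s : ℝ, Complex.exp (2 * Real.pi * Complex.I * ξ * (x + (-|s| : ℝ) * Complex.I)) =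
        Complex.exp ((2 * Real.pi * ξ * x : ℝ) * Complex.I) *
          ((Real.exp (2 * Real.pi * ξ * |s|) : ℝ) : ℂ) := by
      intro s
      rw [Complex.ofReal_exp, ← Complex.exp_add]
      congr 1
      push_cast
      linear_combination (-2 * Real.pi * ξ * |s| : ℂ) * Complex.I_sq
    rw [e, e, ← mul_sub, norm_mul, Complex.norm_exp_ofReal_mul_I, one_mul, ← Complex.ofReal_sub,
      Complex.norm_real, Real.norm_eq_abs]
  have h4 := norm_sub_norm_le (halfLaplace φ (x + (-|t| : ℝ) * Complex.I))
    (halfLaplace φ (x + (-|t₀| : ℝ) * Complex.I))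
  have h5 := hp.1
  have h6 := hp.2
  simp only at h5 h6 ⊢
  linarith

/-- If `1 + F` does not vanish in the closed lower half-plane, for a Fourier-Laplace integral `F`,
then it is bounded below. -/
lemma exists_le_norm_one_add_halfLaplace {φ : ℝ → ℂ} (hφ : IntegrableOn φ (Set.Iio 0))
    (h : ∀ z : ℂ, z.im ≤ 0 → 1 + halfLaplace φ z ≠ 0) :
    ∃ δ > 0, ∀ z : ℂ, z.im ≤ 0 → δ ≤ ‖1 + halfLaplace φ z‖ := by
  obtain ⟨Y, hY⟩ := eventually_atBot.1 ((tendsto_integral_exp_atBot hφ).eventually_lt_const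
    (by norm_num : (0 : ℝ) < 1 / 2))
  have hdeep : ∀ z : ℂ, z.im ≤ Y → ‖halfLaplace φ z‖ < 1 / 2 := by
    intro z hz
    refine lt_of_le_of_lt ((norm_integral_le_integral_norm _).trans_eq ?_) (hY z.im hz)
    simp only [norm_mul, norm_exp_laplace]
  -- Below height `Y` the transform is already small. Compactness of the remaining range of heights
  -- makes the horizontal decay uniform, so `|halfLaplace φ| < 1/2` outside a compact rectangle,
  -- where a minimum is attained.
  have hK : ∀ t₀ ∈ Set.Icc Y (-Y), {p : ℝ × ℝ |
      ‖halfLaplace φ (p.1 + (-|p.2| : ℝ) * Complex.I)‖ < 1 / 2} ∈ cocompact ℝ ×ˢ 𝓝 t₀ :=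
    fun t₀ _ => eventually_norm_halfLaplace_lt hφ (by norm_num) t₀
  have hK2 := isCompact_Icc.mem_prod_nhdsSet_of_forall hK
  obtain ⟨s, hs, u, hu, hsu⟩ := mem_prod_iff.1 hK2
  obtain ⟨K, hKc, hKs⟩ := mem_cocompact.1 hs
  have huI := subset_of_mem_nhdsSet hu
  have hfar : ∀ z : ℂ, z.im ≤ 0 → z ∉ K ×ℂ Set.Icc Y 0 → ‖halfLaplace φ z‖ < 1 / 2 := by
    intro z hz hzK
    by_cases hzY : z.im ≤ Y
    · exact hdeep z hzY
    · have hre : z.re ∈ s := by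
        by_contra hcon
        refine hzK ⟨?_, ⟨(not_le.1 hzY).le, hz⟩⟩
        by_contra hc2
        exact hcon (hKs hc2)
      have him : z.im ∈ u := huI ⟨(not_le.1 hzY).le, by linarith [not_le.1 hzY]⟩
      have := hsu (Set.mk_mem_prod hre him)
      simp only [Set.mem_ofPred_eq, abs_of_nonpos hz, neg_neg, Complex.re_add_im] at this
      exact this
  have hcomp : IsCompact (K ×ℂ Set.Icc Y 0) := hKc.reProdIm isCompact_Icc
  have hcont : ContinuousOn (fun z => ‖1 + halfLaplace φ z‖) (K ×ℂ Set.Icc Y 0) :=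
    ((continuousOn_const.add (continuousOn_halfLaplace hφ)).norm).mono fun z hz => hz.2.2
  have hpos : ∀ z ∈ K ×ℂ Set.Icc Y 0, 0 < ‖1 + halfLaplace φ z‖ :=
    fun z hz => norm_pos_iff.2 (h z hz.2.2)
  obtain ⟨δ, hδ, hδ'⟩ := hcomp.exists_forall_le' hcont hpos
  refine ⟨min δ (1 / 2), by positivity, fun z hz => ?_⟩
  by_cases hzK : z ∈ K ×ℂ Set.Icc Y 0
  · exact (min_le_left _ _).trans (hδ' z hzK)
  · refine (min_le_right _ _).trans ?_
    have h1 := hfar z hz hzK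
    have h2 := norm_sub_le (1 + halfLaplace φ z) (halfLaplace φ z)
    rw [add_sub_cancel_right, norm_one] at h2
    linarith

/-! ### The Hilbert transform and the projection -/

lemma measurable_realSign : Measurable Real.sign := by
  unfold Real.sign
  exact Measurable.ite measurableSet_Iio measurable_const
    (Measurable.ite measurableSet_Ioi measurable_const measurable_const)

lemma aestronglyMeasurable_hilbertSymbol :
    AEStronglyMeasurable (fun ξ : ℝ => -Complex.I * (Real.sign ξ : ℂ)) volume :=
  ((Complex.measurable_ofReal.comp measurable_realSign).const_mul _).aestronglyMeasurable

lemma norm_hilbertSymbol_le (ξ : ℝ) : ‖-Complex.I * (Real.sign ξ : ℂ)‖ ≤ 1 := by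
  rw [norm_mul, norm_neg, Complex.norm_I, one_mul, Complex.norm_real]
  rcases Real.sign_apply_eq ξ with h | h | h <;> simp [h]

section L2

variable {f g : ℝ → ℂ}

lemma memLp_hilbertSymbol_mul (f : ℝ → ℂ) :
    MemLp (fun ξ => -Complex.I * (Real.sign ξ : ℂ) * l2Fourier f ξ) 2 (volume : Measure ℝ) :=
  memLp_bdd_mul (memLp_l2Fourier f) aestronglyMeasurable_hilbertSymbol norm_hilbertSymbol_le

lemma memLp_hilbert (hf : MemLp f 2 (volume : Measure ℝ)) :
    MemLp (hilbert f) 2 (volume : Measure ℝ) :=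
  (fourierMultiplier_spec hf (memLp_hilbertSymbol_mul f)).1

lemma l2Fourier_hilbert (hf : MemLp f 2 (volume : Measure ℝ)) :
    l2Fourier (hilbert f) =ᵐ[volume] fun ξ => -Complex.I * (Real.sign ξ : ℂ) * l2Fourier f ξ :=
  (fourierMultiplier_spec hf (memLp_hilbertSymbol_mul f)).2

lemma proj_eq_add (f : ℝ → ℂ) :
    proj f = fun x => (2⁻¹ : ℂ) * f x + (-Complex.I / 2) * hilbert f x := by
  ext x; simp only [proj]; ring

lemma memLp_proj (hf : MemLp f 2 (volume : Measure ℝ)) :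
    MemLp (proj f) 2 (volume : Measure ℝ) := by
  rw [proj_eq_add]
  exact (hf.const_mul _).add ((memLp_hilbert hf).const_mul _)

lemma l2Fourier_proj (hf : MemLp f 2 (volume : Measure ℝ)) :
    l2Fourier (proj f) =ᵐ[volume] fun ξ => if ξ < 0 then l2Fourier f ξ else 0 := by
  rw [proj_eq_add]
  -- With `sign 0 = 0` the symbol of `proj` equals `1/2` at the origin; that single frequency is
  -- negligible.
  have h0 : ∀ᵐ ξ : ℝ, ξ ≠ 0 := Measure.ae_ne volume 0
  filter_upwards [l2Fourier_add (hf.const_mul (2⁻¹ : ℂ))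
    ((memLp_hilbert hf).const_mul (-Complex.I / 2)), l2Fourier_const_mul hf (2⁻¹ : ℂ),
    l2Fourier_const_mul (memLp_hilbert hf) (-Complex.I / 2), l2Fourier_hilbert hf, h0]
    with ξ h1 h2 h3 h4 h5
  rw [h1, h2, h3, h4]
  rcases lt_or_gt_of_ne h5 with h | h
  · rw [if_pos h, Real.sign_of_neg h]
    push_cast
    linear_combination (-(1 / 2) * l2Fourier f ξ) * Complex.I_sq
  · rw [if_neg h.not_gt, Real.sign_of_pos h]
    push_cast
    linear_combination ((1 / 2) * l2Fourier f ξ) * Complex.I_sq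

lemma proj_add (hf : MemLp f 2 (volume : Measure ℝ)) (hg : MemLp g 2 (volume : Measure ℝ)) :
    proj (fun x => f x + g x) =ᵐ[volume] fun x => proj f x + proj g x := by
  refine ae_eq_of_l2Fourier_ae_eq (memLp_proj (hf.add hg)) ((memLp_proj hf).add (memLp_proj hg)) ?_
  filter_upwards [l2Fourier_proj (hf.add hg), l2Fourier_add hf hg,
    l2Fourier_add (memLp_proj hf) (memLp_proj hg), l2Fourier_proj hf, l2Fourier_proj hg]
    with ξ h1 h2 h3 h4 h5
  rw [show (fun x => f x + g x) = f + g from rfl] at h2 ⊢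
  rw [h1, h2, h3, h4, h5]
  split_ifs <;> simp

lemma proj_const_mul (hf : MemLp f 2 (volume : Measure ℝ)) (a : ℂ) :
    proj (fun x => a * f x) =ᵐ[volume] fun x => a * proj f x := by
  refine ae_eq_of_l2Fourier_ae_eq (memLp_proj (hf.const_mul a)) ((memLp_proj hf).const_mul a) ?_
  filter_upwards [l2Fourier_proj (hf.const_mul a), l2Fourier_const_mul hf a,
    l2Fourier_const_mul (memLp_proj hf) a, l2Fourier_proj hf] with ξ h1 h2 h3 h4
  rw [h1, h2, h3, h4]
  split_ifs <;> simp

lemma proj_of_negFreq (hf : MemLp f 2 (volume : Measure ℝ)) (h : NegFreq f) :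
    proj f =ᵐ[volume] f := by
  refine ae_eq_of_l2Fourier_ae_eq (memLp_proj hf) hf ?_
  have h0 : ∀ᵐ ξ : ℝ, ξ ≠ 0 := Measure.ae_ne volume 0
  filter_upwards [l2Fourier_proj hf, h, h0] with ξ h1 h2 h3
  rw [h1]
  split_ifs with hξ
  · rfl
  · exact (h2 (lt_of_le_of_ne (not_lt.1 hξ) h3.symm)).symm

lemma l2Fourier_zero_fun : l2Fourier (fun _ => (0 : ℂ)) =ᵐ[volume] fun _ => 0 := by
  have h : MemLp (fun _ : ℝ => (0 : ℂ)) 2 volume := MemLp.zero'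
  simpa using l2Fourier_const_mul h 0

/-- Conjugation reflects frequencies, so the conjugate lives on positive frequencies, which the
projection removes. -/
lemma proj_conj_of_negFreq (hf : MemLp f 2 (volume : Measure ℝ)) (h : NegFreq f) :
    proj (fun x => conj (f x)) =ᵐ[volume] fun _ => 0 := by
  refine ae_eq_of_l2Fourier_ae_eq (memLp_proj (memLp_conj hf)) MemLp.zero' ?_
  have h' : ∀ᵐ ξ : ℝ, 0 < -ξ → l2Fourier f (-ξ) = 0 :=
    (Measure.measurePreserving_neg volume).quasiMeasurePreserving.ae h
  filter_upwards [l2Fourier_proj (memLp_conj hf), l2Fourier_conj hf, h', l2Fourier_zero_fun]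
    with ξ h1 h2 h3 h4
  rw [h1, h4]
  split_ifs with hξ
  · rw [h2, h3 (neg_pos.2 hξ), map_zero]
  · rfl

/-- The projection removes the complex conjugates of holomorphic functions. -/
lemma proj_eq_of_eq_add_conj {h m : ℝ → ℂ} (hh : LowerTrace h)
    (hh2 : MemLp h 2 (volume : Measure ℝ)) (hm : LowerTrace m)
    (hm2 : MemLp m 2 (volume : Measure ℝ)) (hf : ∀ x, f x = h x + conj (m x)) :
    proj f =ᵐ[volume] h := by
  have e : f = fun x => h x + conj (m x) := funext hf
  rw [e]
  filter_upwards [proj_add hh2 (memLp_conj hm2), proj_of_negFreq hh2 (hh.negFreq hh2),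
    proj_conj_of_negFreq hm2 (hm.negFreq hm2)] with x h1 h2 h3
  rw [h1, h2, h3, add_zero]

/-- A real-valued square-integrable boundary value of a holomorphic function vanishes. -/
lemma LowerTrace.eq_zero_of_real (hf : LowerTrace f) (h2 : MemLp f 2 (volume : Measure ℝ))
    (hr : ∀ x, conj (f x) = f x) : f = fun _ => 0 := by
  refine eq_of_ae_eq_of_continuous hf.continuous continuous_const ?_
  -- The projection fixes `f` and annihilates its conjugate; for real `f` these are the same
  -- function.
  have h := proj_conj_of_negFreq h2 (hf.negFreq h2)
  simp only [hr] at h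
  exact (proj_of_negFreq h2 (hf.negFreq h2)).symm.trans h

end L2

/-! ### Holomorphic functions in `H²` -/

section H2

variable {f p : ℝ → ℂ}

lemma fourierInv_eq_halfLaplace {φ : ℝ → ℂ} (h : ∀ᵐ ξ : ℝ, 0 < ξ → φ ξ = 0) (x : ℝ) :
    𝓕⁻ φ x = halfLaplace φ x := by
  rw [fourierInv_apply_eq, halfLaplace, ← integral_indicator measurableSet_Iio]
  refine integral_congr_ae ?_
  have h0 : ∀ᵐ ξ : ℝ, ξ ≠ 0 := Measure.ae_ne volume 0
  filter_upwards [h, h0] with ξ h1 h2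
  by_cases hξ : ξ ∈ Set.Iio (0 : ℝ)
  · rw [Set.indicator_of_mem hξ]
  · rw [Set.indicator_of_notMem hξ, h1 (lt_of_le_of_ne (not_lt.1 hξ) h2.symm), mul_zero]

lemma MemH.eq_lowerExt (hp : MemH 2 p) (hn : NegFreq p) (x : ℝ) : lowerExt p x = p x := by
  rw [lowerExt_eq_halfLaplace, ← fourierInv_eq_halfLaplace hn, ← hp.eq_fourierInv]

lemma MemH.deriv_eq_halfLaplace (hp : MemH 2 p) (hn : NegFreq p) (x : ℝ) :
    deriv p x = halfLaplace (fun ξ => 2 * Real.pi * Complex.I * ξ * l2Fourier p ξ) x := by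
  rw [hp.deriv_eq, fourierInv_eq_halfLaplace]
  filter_upwards [hn] with ξ h hξ
  rw [h hξ, mul_zero]

lemma MemH.deriv_lowerExt (hp : MemH 2 p) {z : ℂ} (hz : z.im < 0) :
    deriv (lowerExt p) z =
      halfLaplace (fun ξ => 2 * Real.pi * Complex.I * ξ * l2Fourier p ξ) z :=
  (hasDerivAt_halfLaplace (integrable_of_weight hp.weight).integrableOn hz).deriv

lemma MemH.lowerTrace (hp : MemH 2 p) (hn : NegFreq p) : LowerTrace p :=
  ⟨_, lowerHolomorphic_halfLaplace (integrable_of_weight hp.weight).integrableOn,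
    hp.eq_lowerExt hn⟩

lemma MemH.lowerTrace_deriv (hp : MemH 2 p) (hn : NegFreq p) : LowerTrace (deriv p) :=
  ⟨_, lowerHolomorphic_halfLaplace hp.integrable_deriv_symbol.integrableOn,
    fun x => (hp.deriv_eq_halfLaplace hn x).symm⟩

/-- For nondegenerate coordinates, `1 / (1 + W_α)` extends holomorphically. -/
lemma MemH.exists_lowerTrace_inv (hp : MemH 2 p) (hn : NegFreq p)
    (hd : NondegenerateCoordinates p) : LowerTrace fun x => (1 + deriv p x)⁻¹ := by
  have hφ := hp.integrable_deriv_symbol.integrableOn (s := Set.Iio 0)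
  obtain ⟨δ, hδ, h⟩ := exists_le_norm_one_add_halfLaplace hφ fun z hz => by
    rcases lt_or_eq_of_le hz with h | h
    · rw [← hp.deriv_lowerExt h]
      exact hd.2 z h
    · have e : z = (z.re : ℂ) := Complex.ext (by simp) (by simp [h])
      rw [e, ← hp.deriv_eq_halfLaplace hn]
      exact hd.1 z.re
  exact ⟨_, ((LowerHolomorphic.const 1).add (lowerHolomorphic_halfLaplace hφ)).inv hδ h,
    fun x => by simp only [hp.deriv_eq_halfLaplace hn]⟩

lemma MemH.hilbert (hf : MemH 2 f) : MemH 2 (hilbert f) :=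
  hf.fourierMultiplier aestronglyMeasurable_hilbertSymbol norm_hilbertSymbol_le

lemma MemH.proj_eq (hp : MemH 2 p) (hn : NegFreq p) : proj p = p := by
  refine eq_of_ae_eq_of_continuous ?_ hp.continuous (proj_of_negFreq hp.memLp hn)
  rw [proj_eq_add]
  exact (hp.continuous.const_mul _).add (hp.hilbert.continuous.const_mul _)

/-- The holomorphic function `Hf + if`. -/
def holProfile (f : ℝ → ℂ) : ℝ → ℂ := fun x => hilbert f x + Complex.I * f x

lemma MemH.holProfile (hf : MemH 2 f) : MemH 2 (holProfile f) := hf.hilbert.add (hf.const_mul _)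

lemma MemH.negFreq_holProfile (hf : MemH 2 f) : NegFreq (ConstVorticity.holProfile f) := by
  filter_upwards [l2Fourier_add hf.hilbert.memLp (hf.memLp.const_mul Complex.I),
    l2Fourier_hilbert hf.memLp, l2Fourier_const_mul hf.memLp Complex.I] with ξ h1 h2 h3 hξ
  unfold ConstVorticity.holProfile
  rw [h1, h2, h3, Real.sign_of_pos hξ]
  push_cast
  ring

/-- The symbol `m(ξ) = -i sgn ξ` satisfies `conj (m (-ξ)) = m ξ`, the condition for a multiplier to
preserve real-valued functions. -/
lemma hilbert_real (hf : MemH 2 f) (hr : ∀ x, conj (f x) = f x) (x : ℝ) :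
    conj (hilbert f x) = hilbert f x := by
  have key : (fun x => conj (hilbert f x)) = hilbert f := by
    refine eq_of_ae_eq_of_continuous (Complex.continuous_conj.comp hf.hilbert.continuous)
      hf.hilbert.continuous (ae_eq_of_l2Fourier_ae_eq (memLp_conj hf.hilbert.memLp)
        hf.hilbert.memLp ?_)
    have h1 := l2Fourier_conj hf.memLp
    simp only [hr] at h1
    have h2 := (Measure.measurePreserving_neg (volume : Measure ℝ)).quasiMeasurePreserving.ae
      (l2Fourier_hilbert hf.memLp)
    filter_upwards [l2Fourier_conj hf.hilbert.memLp, h2, l2Fourier_hilbert hf.memLp, h1]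
      with ξ a1 a2 a3 a4
    rw [a1, a2, a3, a4, Real.sign_neg]
    simp
  exact congrFun key x

lemma memLp_absD_symbol (hf : MemH 2 f) :
    MemLp (fun ξ => ((2 * Real.pi * |ξ| : ℝ) : ℂ) * l2Fourier f ξ) 2 (volume : Measure ℝ) := by
  refine memLp_of_norm_le hf.memLp_deriv_symbol
    (AEStronglyMeasurable.mul (Continuous.aestronglyMeasurable (by fun_prop))
      (memLp_l2Fourier f).1) fun ξ => ?_
  simp

/-- The symbols agree: `2πiξ · (-i sgn ξ) = 2π|ξ|`. This rewrites the Babenko equation through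
derivatives of Hilbert transforms, that is, through real parts of derivatives of holomorphic
profiles. -/
lemma absD_ae_eq (hf : MemH 2 f) : absD f =ᵐ[volume] deriv (hilbert f) := by
  obtain ⟨h1, h2⟩ := fourierMultiplier_spec hf.memLp (memLp_absD_symbol hf)
  refine ae_eq_of_l2Fourier_ae_eq h1 hf.hilbert.memLp_deriv ?_
  filter_upwards [h2, hf.hilbert.l2Fourier_deriv, l2Fourier_hilbert hf.memLp] with ξ a1 a2 a3
  rw [absD, a1, a2, a3]
  rcases lt_trichotomy ξ 0 with h | h | h
  · rw [Real.sign_of_neg h, abs_of_neg h]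
    push_cast
    linear_combination (-2 * Real.pi * ξ * l2Fourier f ξ) * Complex.I_sq
  · simp [h]
  · rw [Real.sign_of_pos h, abs_of_pos h]
    push_cast
    linear_combination (2 * Real.pi * ξ * l2Fourier f ξ) * Complex.I_sq

/-! ### Translations -/

lemma fourierMultiplier_comp_add {m : ℝ → ℂ} (hf : MemLp f 2 (volume : Measure ℝ))
    (hm : MemLp (fun ξ => m ξ * l2Fourier f ξ) 2 (volume : Measure ℝ)) (a : ℝ) :
    fourierMultiplier m (fun x => f (x + a)) =ᵐ[volume]
      fun x => fourierMultiplier m f (x + a) := by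
  have hm' : MemLp (fun ξ => m ξ * l2Fourier (fun x => f (x + a)) ξ) 2 (volume : Measure ℝ) := by
    refine (memLp_congr_ae ?_).1 (memLp_expChar_mul hm a)
    filter_upwards [l2Fourier_comp_add hf a] with ξ h
    rw [h]; ring
  obtain ⟨h1, h2⟩ := fourierMultiplier_spec hf hm
  obtain ⟨h3, h4⟩ := fourierMultiplier_spec (memLp_comp_add hf a) hm'
  refine ae_eq_of_l2Fourier_ae_eq h3 (memLp_comp_add h1 a) ?_
  filter_upwards [h2, h4, l2Fourier_comp_add hf a, l2Fourier_comp_add h1 a] with ξ a1 a2 a3 a4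
  rw [a2, a3, a4, a1]; ring

lemma absD_comp_add (hf : MemH 2 f) (a : ℝ) :
    absD (fun x => f (x + a)) =ᵐ[volume] fun x => absD f (x + a) :=
  fourierMultiplier_comp_add hf.memLp (memLp_absD_symbol hf) a

lemma hilbert_comp_add (hf : MemH 2 f) (a : ℝ) :
    hilbert (fun x => f (x + a)) = fun x => hilbert f (x + a) :=
  eq_of_ae_eq_of_continuous (hf.comp_add a).hilbert.continuous
    (hf.hilbert.continuous.comp (by fun_prop))
    (fourierMultiplier_comp_add hf.memLp (memLp_hilbertSymbol_mul f) a)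

lemma lowerExt_comp_add (hf : MemLp f 2 (volume : Measure ℝ)) (a : ℝ) (z : ℂ) :
    lowerExt (fun x => f (x + a)) z = lowerExt f (z + a) := by
  refine integral_congr_ae (ae_restrict_of_ae ?_)
  filter_upwards [l2Fourier_comp_add hf a] with ξ h
  rw [h, expChar, ← mul_assoc, ← Complex.exp_add]
  congr 2
  ring

lemma NondegenerateCoordinates.comp_add (hf : MemLp f 2 (volume : Measure ℝ))
    (h : NondegenerateCoordinates f) (a : ℝ) : NondegenerateCoordinates fun x => f (x + a) := by
  refine ⟨fun x => ?_, fun z hz => ?_⟩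
  · rw [deriv_comp_add_const]
    exact h.1 _
  · rw [funext (lowerExt_comp_add hf a), deriv_comp_add_const]
    exact h.2 _ (by simpa using hz)

lemma SolvesBabenko.comp_add {g γ c : ℝ} {U : ℝ → ℝ} (hU : MemH 2 fun x => (U x : ℂ))
    (hB : SolvesBabenko g γ c U) (a : ℝ) : SolvesBabenko g γ c fun x => U (x + a) := by
  have h := (quasiMeasurePreserving_add_right a).ae hB
  have h2 : MemH 2 fun x => (U x : ℂ) ^ 2 := hU.pow 1
  have h3 : MemH 2 fun x => (U x : ℂ) ^ 3 := hU.pow 2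
  filter_upwards [h, absD_comp_add hU a, absD_comp_add h2 a, absD_comp_add h3 a] with x b b1 b2 b3
  rw [b1, b2, b3]
  exact b

end H2

/-! ### The profiles -/

lemma conj_deriv_of_real {f : ℝ → ℂ} (hf : Differentiable ℝ f) (hr : ∀ x, conj (f x) = f x)
    (x : ℝ) : conj (deriv f x) = deriv f x := by
  have h : HasDerivAt (fun x => conj (f x)) (conj (deriv f x)) x := (hf x).hasDerivAt.star
  simp only [hr] at h
  exact h.deriv.symm

lemma MemH.differentiable {f : ℝ → ℂ} (hf : MemH 2 f) : Differentiable ℝ f :=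
  fun x => (hf.hasDerivAt x).differentiableAt

lemma deriv_holProfile {f : ℝ → ℂ} (hf : MemH 2 f) (x : ℝ) :
    deriv (holProfile f) x = deriv (hilbert f) x + Complex.I * deriv f x :=
  ((hf.hilbert.hasDerivAt x).add ((hf.hasDerivAt x).const_mul _)).deriv

lemma conj_deriv_holProfile {f : ℝ → ℂ} (hf : MemH 2 f) (hr : ∀ x, conj (f x) = f x) (x : ℝ) :
    conj (deriv (holProfile f) x) = deriv (hilbert f) x - Complex.I * deriv f x := by
  rw [deriv_holProfile hf, map_add, map_mul, Complex.conj_I,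
    conj_deriv_of_real hf.hilbert.differentiable (hilbert_real hf hr),
    conj_deriv_of_real hf.differentiable hr]
  ring

lemma conj_holProfile {f : ℝ → ℂ} (hf : MemH 2 f) (hr : ∀ x, conj (f x) = f x) (x : ℝ) :
    conj (holProfile f x) = hilbert f x - Complex.I * f x := by
  rw [holProfile, map_add, map_mul, Complex.conj_I, hilbert_real hf hr, hr]
  ring

lemma memLp_conj_mul {f k : ℝ → ℂ} (hk : LowerTrace k) (hf : MemLp f 2 (volume : Measure ℝ)) :
    MemLp (fun x => conj (k x) * f x) 2 (volume : Measure ℝ) := by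
  simpa using memLp_conj (hk.memLp_mul (memLp_conj hf))

lemma profileQ_eq (γ c : ℝ) (U : ℝ → ℝ) : profileQ γ c U = fun x =>
    -(c : ℂ) * profileW U x + -((γ : ℂ) / 2) * holProfile (fun x => (U x : ℂ) ^ 2) x := by
  ext x
  simp only [profileQ, profileW, holProfile]
  ring

section Wave

variable {g γ c : ℝ} {U : ℝ → ℝ}

lemma memH_profileW (hU : MemH 2 fun x => (U x : ℂ)) : MemH 2 (profileW U) := hU.holProfile

lemma memH_profileQ (γ c : ℝ) (hU : MemH 2 fun x => (U x : ℂ)) : MemH 2 (profileQ γ c U) := by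
  rw [profileQ_eq]
  exact ((memH_profileW hU).const_mul _).add ((hU.pow 1).holProfile.const_mul _)

lemma profileW_comp_add (hU : MemH 2 fun x => (U x : ℂ)) (a x : ℝ) :
    profileW (fun x => U (x + a)) x = profileW U (x + a) := by
  simp only [profileW, hilbert_comp_add hU a]

lemma profileQ_comp_add (γ c : ℝ) (hU : MemH 2 fun x => (U x : ℂ)) (a x : ℝ) :
    profileQ γ c (fun x => U (x + a)) x = profileQ γ c U (x + a) := by
  simp only [profileQ, hilbert_comp_add hU a, hilbert_comp_add (hU.pow 1) a]

lemma negFreq_profileW (hU : MemH 2 fun x => (U x : ℂ)) : NegFreq (profileW U) :=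
  hU.negFreq_holProfile

lemma lowerTrace_profileW (hU : MemH 2 fun x => (U x : ℂ)) : LowerTrace (profileW U) :=
  hU.holProfile.lowerTrace hU.negFreq_holProfile

lemma lowerTrace_profileQ (γ c : ℝ) (hU : MemH 2 fun x => (U x : ℂ)) :
    LowerTrace (profileQ γ c U) := by
  rw [profileQ_eq]
  have hU2 : MemH 2 fun x => (U x : ℂ) ^ 2 := hU.pow 1
  exact ((lowerTrace_profileW hU).const_mul _).add
    ((hU2.holProfile.lowerTrace hU2.negFreq_holProfile).const_mul _)

lemma negFreq_profileQ (γ c : ℝ) (hU : MemH 2 fun x => (U x : ℂ)) : NegFreq (profileQ γ c U) :=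
  (lowerTrace_profileQ γ c hU).negFreq (memH_profileQ γ c hU).memLp

/-! ### Pointwise formulas for the profiles, their derivatives and conjugates -/

lemma deriv_sq (hU : MemH 2 fun x => (U x : ℂ)) (x : ℝ) :
    deriv (fun x => (U x : ℂ) ^ 2) x = 2 * U x * deriv (fun x => (U x : ℂ)) x := by
  refine ((hU.hasDerivAt x).pow 2).deriv.trans ?_
  simp

lemma deriv_cube (hU : MemH 2 fun x => (U x : ℂ)) (x : ℝ) :
    deriv (fun x => (U x : ℂ) ^ 3) x = 3 * (U x : ℂ) ^ 2 * deriv (fun x => (U x : ℂ)) x := by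
  refine ((hU.hasDerivAt x).pow 3).deriv.trans ?_
  simp

section Pointwise

lemma conj_ofReal_pow (U : ℝ → ℝ) (n : ℕ) (x : ℝ) : conj ((U x : ℂ) ^ n) = (U x : ℂ) ^ n := by
  rw [map_pow, Complex.conj_ofReal]

variable (hU : MemH 2 fun x => (U x : ℂ)) (x : ℝ)
include hU

lemma conj_profileW : conj (profileW U x) =
    hilbert (fun x => (U x : ℂ)) x - Complex.I * U x :=
  conj_holProfile hU (fun _ => Complex.conj_ofReal _) x

lemma deriv_profileW : deriv (profileW U) x =
    deriv (hilbert fun x => (U x : ℂ)) x + Complex.I * deriv (fun x => (U x : ℂ)) x :=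
  deriv_holProfile hU x

lemma conj_deriv_profileW : conj (deriv (profileW U) x) =
    deriv (hilbert fun x => (U x : ℂ)) x - Complex.I * deriv (fun x => (U x : ℂ)) x :=
  conj_deriv_holProfile hU (fun _ => Complex.conj_ofReal _) x

lemma deriv_profile_sq : deriv (holProfile fun x => (U x : ℂ) ^ 2) x =
    deriv (hilbert fun x => (U x : ℂ) ^ 2) x
      + Complex.I * (2 * U x * deriv (fun x => (U x : ℂ)) x) := by
  rw [deriv_holProfile (hU.pow 1), deriv_sq hU]

lemma conj_deriv_profile_sq : conj (deriv (holProfile fun x => (U x : ℂ) ^ 2) x) =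
    deriv (hilbert fun x => (U x : ℂ) ^ 2) x
      - Complex.I * (2 * U x * deriv (fun x => (U x : ℂ)) x) := by
  rw [conj_deriv_holProfile (hU.pow 1) (conj_ofReal_pow U 2), deriv_sq hU]

lemma conj_deriv_profile_cube : conj (deriv (holProfile fun x => (U x : ℂ) ^ 3) x) =
    deriv (hilbert fun x => (U x : ℂ) ^ 3) x
      - Complex.I * (3 * (U x : ℂ) ^ 2 * deriv (fun x => (U x : ℂ)) x) := by
  rw [conj_deriv_holProfile (hU.pow 2) (conj_ofReal_pow U 3), deriv_cube hU]

lemma conj_profileQ (γ c : ℝ) : conj (profileQ γ c U x) =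
    -(c : ℂ) * (hilbert (fun x => (U x : ℂ)) x - Complex.I * U x)
      + -((γ : ℂ) / 2) * (hilbert (fun x => (U x : ℂ) ^ 2) x - Complex.I * (U x : ℂ) ^ 2) := by
  rw [profileQ_eq, map_add, map_mul, map_mul, conj_profileW hU,
    conj_holProfile (hU.pow 1) (conj_ofReal_pow U 2)]
  simp [Complex.conj_ofNat]

lemma deriv_profileQ (γ c : ℝ) : deriv (profileQ γ c U) x =
    -(c : ℂ) * (deriv (hilbert fun x => (U x : ℂ)) x
        + Complex.I * deriv (fun x => (U x : ℂ)) x)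
      + -((γ : ℂ) / 2) * (deriv (hilbert fun x => (U x : ℂ) ^ 2) x
        + Complex.I * (2 * U x * deriv (fun x => (U x : ℂ)) x)) := by
  rw [profileQ_eq, ← deriv_profileW hU, ← deriv_profile_sq hU]
  exact ((((memH_profileW hU).hasDerivAt x).const_mul _).add
    (((hU.pow 1).holProfile.hasDerivAt x).const_mul _)).deriv

lemma conj_deriv_profileQ (γ c : ℝ) : conj (deriv (profileQ γ c U) x) =
    -(c : ℂ) * (deriv (hilbert fun x => (U x : ℂ)) x
        - Complex.I * deriv (fun x => (U x : ℂ)) x)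
      + -((γ : ℂ) / 2) * (deriv (hilbert fun x => (U x : ℂ) ^ 2) x
        - Complex.I * (2 * U x * deriv (fun x => (U x : ℂ)) x)) := by
  rw [deriv_profileQ hU, ← deriv_profileW hU, ← deriv_profile_sq hU, ← conj_deriv_profileW hU,
    ← conj_deriv_profile_sq hU]
  simp [Complex.conj_ofNat]

/-- The functions `1 / (1 + W_α)` and its conjugate, as inverses. -/
lemma inv_profile (hW : NondegenerateCoordinates (profileW U)) :
    (1 + (deriv (hilbert fun x => (U x : ℂ)) x + Complex.I * deriv (fun x => (U x : ℂ)) x))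
        * (1 + deriv (profileW U) x)⁻¹ = 1 ∧
    (1 + (deriv (hilbert fun x => (U x : ℂ)) x - Complex.I * deriv (fun x => (U x : ℂ)) x))
        * conj ((1 + deriv (profileW U) x)⁻¹) = 1 := by
  have h := mul_inv_cancel₀ (hW.1 x)
  refine ⟨by rwa [← deriv_profileW hU], ?_⟩
  have h2 := congrArg conj h
  rwa [map_mul, map_add, map_one, conj_deriv_profileW hU] at h2

end Pointwise

/-! ### The projected nonlinear terms and the two equations for the profile -/

lemma div_jac (w : ℝ → ℂ) (x : ℝ) (a : ℂ) :
    a / jac w x = a * ((1 + deriv w x)⁻¹ * conj ((1 + deriv w x)⁻¹)) := by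
  have e : jac w x = (1 + deriv w x) * conj (1 + deriv w x) := by
    rw [jac, Complex.mul_conj, Complex.normSq_eq_norm_sq]
  rw [e, div_eq_mul_inv, mul_inv, map_inv₀]

/-- The holomorphic function `-(c W_α + i (γ/2) W) / (1 + W_α)`. -/
def velocity (γ c : ℝ) (w : ℝ → ℂ) (x : ℝ) : ℂ :=
  -((c * deriv w x + Complex.I * (γ / 2) * w x) * (1 + deriv w x)⁻¹)

lemma opFbar_profile (hU : MemH 2 fun x => (U x : ℂ))
    (hW : NondegenerateCoordinates (profileW U)) :
    opFbar γ (profileW U) (profileQ γ c U) =ᵐ[volume] velocity γ c (profileW U) := by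
  have hw := memH_profileW hU
  have hq := memH_profileQ γ c hU
  have hk := hw.exists_lowerTrace_inv (negFreq_profileW hU) hW
  set w := profileW U with hwdef
  set q := profileQ γ c U with hqdef
  have hv2 : MemLp (velocity γ c w) 2 (volume : Measure ℝ) := by
    refine (memLp_congr_ae (ae_of_all _ fun x => ?_)).1 (hk.memLp_mul
      ((hw.memLp_deriv.const_mul (-(c : ℂ))).add (hw.memLp.const_mul (-(Complex.I * (γ / 2))))))
    simp only [velocity, Pi.add_apply]
    ring
  have hv : LowerTrace (velocity γ c w) := by
    have h := hk.mul (((hw.lowerTrace_deriv (negFreq_profileW hU)).const_mul (-(c : ℂ))).add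
      ((lowerTrace_profileW hU).const_mul (-(Complex.I * (γ / 2)))))
    convert h using 2 with x
    simp only [velocity]
    ring
  set f₁ : ℝ → ℂ := fun α => (deriv q α - star (deriv q α)) / jac w α with hf₁
  set f₂ : ℝ → ℂ := fun α => w α / (1 + star (deriv w α)) + star (w α) / (1 + deriv w α) with hf₂
  have h₁ : MemLp f₁ 2 (volume : Measure ℝ) := by
    refine (memLp_congr_ae (ae_of_all _ fun x => ?_)).1 (memLp_conj_mul hk
      (hk.memLp_mul (hq.memLp_deriv.sub (memLp_conj hq.memLp_deriv))))
    simp only [hf₁, Pi.sub_apply, div_jac, ← starRingEnd_apply]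
    ring
  have h₂ : MemLp f₂ 2 (volume : Measure ℝ) := by
    refine (memLp_congr_ae (ae_of_all _ fun x => ?_)).1 ((memLp_conj_mul hk hw.memLp).add
      (hk.memLp_mul (memLp_conj hw.memLp)))
    simp only [hf₂, Pi.add_apply, ← starRingEnd_apply, map_inv₀, map_add, map_one]
    ring
  -- The whole argument of the projection is `v - conj v` with `v` the claimed velocity, so `P`
  -- returns `v`. The two terms are treated together, since this decomposition is one of their sum.
  have hsum : proj (fun x => f₁ x + -(Complex.I * (γ / 2)) * f₂ x) =ᵐ[volume] velocity γ c w := by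
    refine proj_eq_of_eq_add_conj hv hv2
      (m := fun x => -1 * velocity γ c w x) (hv.const_mul _) (hv2.const_mul _) fun x => ?_
    simp only [hf₁, hf₂, div_jac, ← starRingEnd_apply, velocity]
    obtain ⟨hk1, hk2⟩ := inv_profile hU x hW
    have e₁ : w x / (1 + conj (deriv w x)) = w x * conj ((1 + deriv w x)⁻¹) := by
      rw [map_inv₀, map_add, map_one, div_eq_mul_inv]
    rw [e₁, div_eq_mul_inv (conj (w x))]
    simp only [map_mul, map_neg, map_add, map_div₀, Complex.conj_ofReal, Complex.conj_I,
      Complex.conj_ofNat, map_one]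
    rw [← hwdef] at hk1 hk2
    generalize conj ((1 + deriv w x)⁻¹) = kb at *
    generalize (1 + deriv w x)⁻¹ = k at *
    rw [hwdef, hqdef, conj_deriv_profileQ hU, deriv_profileQ hU, conj_deriv_profileW hU,
      conj_profileW hU, deriv_profileW hU, profileW]
    generalize deriv (hilbert fun x => (U x : ℂ)) x = a1 at *
    generalize deriv (fun x => (U x : ℂ)) x = u1 at *
    linear_combination (-(c : ℂ) - γ * U x) * (kb * hk1 - k * hk2) + (c : ℂ) * (hk1 - hk2)
      + γ * (U x : ℂ) * (k - kb) * Complex.I_sq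
  filter_upwards [hsum, proj_add h₁ (h₂.const_mul (-(Complex.I * (γ / 2)))),
    proj_const_mul h₂ (-(Complex.I * (γ / 2)))] with x a1 a2 a3
  rw [← a1, a2, a3]
  simp only [opFbar, opF, opF1, ← hf₁, ← hf₂]
  ring

/-- The Bernoulli equation on the free surface. -/
lemma bernoulli (hU : MemH 2 fun x => (U x : ℂ)) (hB : SolvesBabenko g γ c U)
    (hW : NondegenerateCoordinates (profileW U)) (x : ℝ) :
    (deriv (profileQ γ c U) x * (1 + deriv (profileW U) x)⁻¹ + c + γ * U x)
      * (conj (deriv (profileQ γ c U) x) * conj ((1 + deriv (profileW U) x)⁻¹) + c + γ * U x)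
      - (c : ℂ) ^ 2 + 2 * g * U x = 0 := by
  have hw := memH_profileW hU
  have hq := memH_profileQ γ c hU
  have hU2 : MemH 2 fun x => (U x : ℂ) ^ 2 := hU.pow 1
  have hU3 : MemH 2 fun x => (U x : ℂ) ^ 3 := hU.pow 2
  have hk := hw.exists_lowerTrace_inv (negFreq_profileW hU) hW
  have hw1 := hw.lowerTrace_deriv (negFreq_profileW hU)
  have hq1 := hq.lowerTrace_deriv (negFreq_profileQ γ c hU)
  have hv1 := hU2.holProfile.lowerTrace_deriv hU2.negFreq_holProfile
  have hs1 := hU3.holProfile.lowerTrace_deriv hU3.negFreq_holProfile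
  set N : ℝ → ℂ := fun x =>
    (deriv (profileQ γ c U) x * (1 + deriv (profileW U) x)⁻¹ + c + γ * U x)
      * (conj (deriv (profileQ γ c U) x) * conj ((1 + deriv (profileW U) x)⁻¹) + c + γ * U x)
      - (c : ℂ) ^ 2 + 2 * g * U x with hN
  set M : ℝ → ℂ := fun x =>
    deriv (profileQ γ c U) x * (1 + deriv (profileW U) x)⁻¹ * deriv (profileQ γ c U) x
      + (2 * c) * deriv (profileQ γ c U) x + (2 * (c : ℂ) ^ 2) * deriv (profileW U) x
      + (-((γ : ℂ) ^ 2 / 3)) * deriv (holProfile fun x => (U x : ℂ) ^ 3) x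
      + (-(g : ℂ)) * deriv (holProfile fun x => (U x : ℂ) ^ 2) x with hM
  have hMtr : LowerTrace M := ((((hq1.mul hk).mul hq1).add (hq1.const_mul _)).add
    (hw1.const_mul _)).add (hs1.const_mul _) |>.add (hv1.const_mul _)
  have hM2 : MemLp M 2 (volume : Measure ℝ) :=
    (((((hq1.mul hk).memLp_mul hq.memLp_deriv).add (hq.memLp_deriv.const_mul _)).add
      (hw.memLp_deriv.const_mul _)).add (hU3.holProfile.memLp_deriv.const_mul _)).add
      (hU2.holProfile.memLp_deriv.const_mul _)
  have hNc : Continuous N := by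
    have h1 := hk.continuous
    have h2 := hq1.continuous
    have h3 := hU.continuous
    exact ((((h2.mul h1).add continuous_const).add (continuous_const.mul h3)).mul
      ((((Complex.continuous_conj.comp h2).mul (Complex.continuous_conj.comp h1)).add
        continuous_const).add (continuous_const.mul h3)) |>.sub continuous_const).add
      (continuous_const.mul h3)
  -- The Babenko equation enters here, doubled. It holds only almost everywhere; continuity of both
  -- sides makes the identity pointwise.
  have hNM : (fun x => N x * (1 + deriv (profileW U) x)) = fun x => conj (M x) := by
    refine eq_of_ae_eq_of_continuous (hNc.mul (continuous_const.add hw1.continuous))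
      (Complex.continuous_conj.comp hMtr.continuous) ?_
    filter_upwards [hB, absD_ae_eq hU, absD_ae_eq hU2, absD_ae_eq hU3] with x hx h1 h2 h3
    rw [h1, h2, h3] at hx
    obtain ⟨hk1, hk2⟩ := inv_profile hU x hW
    simp only [hN, hM, map_mul, map_neg, map_add, map_div₀, Complex.conj_ofReal, map_pow,
      Complex.conj_ofNat]
    generalize conj ((1 + deriv (profileW U) x)⁻¹) = kb at *
    generalize (1 + deriv (profileW U) x)⁻¹ = k at *
    rw [conj_deriv_profileQ hU, deriv_profileQ hU, conj_deriv_profileW hU, deriv_profileW hU,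
      conj_deriv_profile_sq hU, conj_deriv_profile_cube hU]
    generalize deriv (hilbert fun x => (U x : ℂ)) x = a1 at *
    generalize deriv (hilbert fun x => (U x : ℂ) ^ 2) x = b1 at *
    generalize deriv (hilbert fun x => (U x : ℂ) ^ 3) x = d1 at *
    generalize deriv (fun x => (U x : ℂ)) x = u1 at *
    generalize (U x : ℂ) = u at *
    push_cast at hx
    have e1 : ∃ q, -(c : ℂ) * (a1 + Complex.I * u1)
        + -((γ : ℂ) / 2) * (b1 + Complex.I * (2 * u * u1)) = q := ⟨_, rfl⟩
    have e2 : ∃ q, -(c : ℂ) * (a1 - Complex.I * u1)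
        + -((γ : ℂ) / 2) * (b1 - Complex.I * (2 * u * u1)) = q := ⟨_, rfl⟩
    obtain ⟨q1, e1⟩ := e1
    obtain ⟨q1b, e2⟩ := e2
    rw [e1, e2]
    -- The kinematic condition: `q_α + (c + γU)(1 + w_α)` is real, because the imaginary part of
    -- `q_α` is `-(c + γU) U_α`. It replaces the holomorphic factor of `N (1 + w_α)` by its
    -- conjugate.
    have e3 : q1 + (c + γ * u) * (1 + (a1 + Complex.I * u1))
        = q1b + (c + γ * u) * (1 + (a1 - Complex.I * u1)) := by
      rw [← e1, ← e2]; ring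
    linear_combination (q1b * kb + c + γ * u) * q1 * hk1 + (q1b * kb + c + γ * u) * e3
      + (c + γ * u) * q1b * hk2 - 2 * γ * u * e2 + 2 * hx
  have hNr : ∀ x, conj (N x) = N x := by
    intro x
    simp only [hN, map_mul, map_add, map_sub, map_pow, Complex.conj_ofReal, Complex.conj_conj,
      Complex.conj_ofNat]
    ring
  -- Conjugating `hNM` and using that `N` is real shows the holomorphic product on the left to be
  -- real as well.
  have hreal : ∀ x, (1 + deriv (profileW U) x) * M x
      = N x * ((1 + deriv (profileW U) x) * conj (1 + deriv (profileW U) x)) := by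
    intro x
    have h := congrArg conj (congrFun hNM x)
    rw [Complex.conj_conj, map_mul, hNr] at h
    rw [← h]; ring
  have h0 := LowerTrace.eq_zero_of_real (((LowerTrace.const 1).add hw1).mul hMtr)
    (((LowerTrace.const 1).add hw1).memLp_mul hM2) fun x => by
      rw [hreal, map_mul, map_mul, Complex.conj_conj, hNr, mul_comm (conj (1 + _))]
  have h1 := congrFun h0 x
  simp only [hreal] at h1
  have hne := hW.1 x
  have hne2 : conj (1 + deriv (profileW U) x) ≠ 0 := (map_ne_zero _).2 hne
  exact (mul_eq_zero.1 h1).resolve_right (mul_ne_zero hne hne2)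

/-- The first equation of the system for the profile. -/
lemma equation_W_profile (hU : MemH 2 fun x => (U x : ℂ))
    (hW : NondegenerateCoordinates (profileW U)) :
    ∀ᵐ α : ℝ, c * deriv (profileW U) α
      + (deriv (profileW U) α + 1) * opFbar γ (profileW U) (profileQ γ c U) α
      + Complex.I * (γ / 2) * profileW U α = 0 := by
  filter_upwards [opFbar_profile (γ := γ) (c := c) hU hW] with x h
  rw [h, velocity]
  have := mul_inv_cancel₀ (hW.1 x)
  linear_combination (-(c * deriv (profileW U) x + Complex.I * (γ / 2) * profileW U x)) * this

/-- The second equation of the system for the profile. -/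
lemma equation_Q_profile (hU : MemH 2 fun x => (U x : ℂ)) (hB : SolvesBabenko g γ c U)
    (hW : NondegenerateCoordinates (profileW U)) :
    ∀ᵐ α : ℝ, c * deriv (profileQ γ c U) α - Complex.I * g * profileW U α
      + opFbar γ (profileW U) (profileQ γ c U) α * deriv (profileQ γ c U) α
      + Complex.I * γ * profileQ γ c U α
      + proj (fun β => ((‖deriv (profileQ γ c U) β‖ ^ 2 : ℝ) : ℂ) / jac (profileW U) β) α
      - Complex.I * (γ / 2) * opT1 (profileW U) (profileQ γ c U) α = 0 := by
  have hw := memH_profileW hU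
  have hq := memH_profileQ γ c hU
  have hwt := lowerTrace_profileW hU
  have hqt := lowerTrace_profileQ γ c hU
  have hk := hw.exists_lowerTrace_inv (negFreq_profileW hU) hW
  have hq1 := hq.lowerTrace_deriv (negFreq_profileQ γ c hU)
  set w := profileW U with hwdef
  set q := profileQ γ c U with hqdef
  set f₁ : ℝ → ℂ := fun β => ((‖deriv q β‖ ^ 2 : ℝ) : ℂ) / jac w β with hf₁
  set f₂ : ℝ → ℂ := fun α => w α * star (deriv q α) / (1 + star (deriv w α))
    - star (w α) * deriv q α / (1 + deriv w α) with hf₂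
  have e₁ : ∀ x, f₁ x = conj (deriv q x * (1 + deriv w x)⁻¹)
      * ((1 + deriv w x)⁻¹ * deriv q x) := by
    intro x
    simp only [hf₁, div_jac]
    rw [← Complex.normSq_eq_norm_sq, ← Complex.mul_conj, map_mul]
    ring
  have e₂ : ∀ x, f₂ x = conj (deriv q x * (1 + deriv w x)⁻¹) * w x
      + (-1) * (deriv q x * (1 + deriv w x)⁻¹ * conj (w x)) := by
    intro x
    simp only [hf₂, ← starRingEnd_apply, map_mul, map_inv₀, map_add, map_one]
    ring
  have h₁ : MemLp f₁ 2 (volume : Measure ℝ) := by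
    rw [funext e₁]
    exact memLp_conj_mul (hq1.mul hk) (hk.memLp_mul hq.memLp_deriv)
  have h₂ : MemLp f₂ 2 (volume : Measure ℝ) := by
    rw [funext e₂]
    exact (memLp_conj_mul (hq1.mul hk) hw.memLp).add
      (((hq1.mul hk).memLp_mul (memLp_conj hw.memLp)).const_mul _)
  -- `E` is what the second equation requires of the two projected terms, once the velocity is
  -- inserted and `c q_α - c w_α k q_α` is simplified to `c k q_α`.
  set E : ℝ → ℂ := fun x => (-(c : ℂ)) * ((1 + deriv w x)⁻¹ * deriv q x)
    + Complex.I * (γ / 2) * (deriv q x * (1 + deriv w x)⁻¹ * w x)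
    + Complex.I * g * w x + (-(Complex.I * γ)) * q x with hE
  have hEt : LowerTrace E := (((hk.mul hq1).const_mul _).add
    (((hq1.mul hk).mul hwt).const_mul _)).add (hwt.const_mul _) |>.add (hqt.const_mul _)
  have hE2 : MemLp E 2 (volume : Measure ℝ) :=
    ((((hk.memLp_mul hq.memLp_deriv).const_mul _).add
      (((hq1.mul hk).memLp_mul hw.memLp).const_mul _)).add (hw.memLp.const_mul _)).add
      (hq.memLp.const_mul _)
  -- By the Bernoulli identity the argument of the projection is `E + conj E`. The differences `w -
  -- conj w = 2iU` and `q - conj q = -2i(cU + (γ/2)U²)` supply its gravity and vorticity terms.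
  have hsum : proj (fun x => f₁ x + -(Complex.I * (γ / 2)) * f₂ x) =ᵐ[volume] E := by
    refine proj_eq_of_eq_add_conj hEt hE2 hEt hE2 fun x => ?_
    have hN := bernoulli hU hB hW x
    rw [← hwdef, ← hqdef] at hN
    simp only [e₁, e₂, hE, map_mul, map_neg, map_add, map_div₀, Complex.conj_ofReal,
      Complex.conj_I, Complex.conj_ofNat]
    generalize conj ((1 + deriv w x)⁻¹) = kb at *
    generalize (1 + deriv w x)⁻¹ = k at *
    generalize conj (deriv q x) = q1b at *
    generalize deriv q x = q1 at *
    rw [hwdef, hqdef, conj_profileW hU, conj_profileQ hU, profileW, profileQ]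
    generalize hilbert (fun x => (U x : ℂ)) x = a at *
    generalize hilbert (fun x => (U x : ℂ) ^ 2) x = b at *
    generalize (U x : ℂ) = u at *
    linear_combination hN - (γ * u * (q1 * k + q1b * kb) + 2 * g * u + 2 * c * γ * u
      + (γ : ℂ) ^ 2 * u ^ 2) * Complex.I_sq
  filter_upwards [opFbar_profile (γ := γ) (c := c) hU hW, hsum,
    proj_add h₁ (h₂.const_mul (-(Complex.I * (γ / 2)))),
    proj_const_mul h₂ (-(Complex.I * (γ / 2)))] with x a0 a1 a2 a3
  rw [a2, a3] at a1
  have a4 : opT1 w q x = proj f₂ x := rfl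
  rw [a4, a0, velocity]
  have hk1 := mul_inv_cancel₀ (hW.1 x)
  rw [← hwdef]
  simp only [hE] at a1
  linear_combination a1 - c * deriv q x * hk1

end Wave

end ConstVorticity

end

/-! ### From the profile to the travelling wave -/

theorem mainTheorem6 (g γ c : ℝ) (hg : 0 < g) (U : ℝ → ℝ)
    (hU : ConstVorticity.MemH 2 (fun x => (U x : ℂ))) (hU0 : U ≠ 0)
    (hB : ConstVorticity.SolvesBabenko g γ c U)
    (hW : ConstVorticity.NondegenerateCoordinates (ConstVorticity.profileW U)) (x₀ : ℝ) :
    ConstVorticity.IsSolitaryWave g γ c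
      (fun α => ConstVorticity.profileW U (α + x₀))
      (fun α => ConstVorticity.profileQ γ c U (α + x₀)) := by
  have hw := ConstVorticity.memH_profileW hU
  have hq := ConstVorticity.memH_profileQ γ c hU
  -- At time `t` the wave is the profile of the translate of `U` by `c t + x₀`. All hypotheses are
  -- translation invariant, so the profile equations apply at each time.
  have hUt : ∀ t : ℝ, ConstVorticity.MemH 2 (fun x => ((U (x + (c * t + x₀)) : ℝ) : ℂ)) :=
    fun t => hU.comp_add _
  have eW : ∀ t : ℝ, (fun α => ConstVorticity.profileW U (α + c * t + x₀))
      = ConstVorticity.profileW fun x => U (x + (c * t + x₀)) := by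
    intro t
    ext α
    rw [add_assoc]
    exact (ConstVorticity.profileW_comp_add hU _ α).symm
  have eQ : ∀ t : ℝ, (fun α => ConstVorticity.profileQ γ c U (α + c * t + x₀))
      = ConstVorticity.profileQ γ c fun x => U (x + (c * t + x₀)) := by
    intro t
    ext α
    rw [add_assoc]
    exact (ConstVorticity.profileQ_comp_add γ c hU _ α).symm
  have hWt : ∀ t : ℝ, ConstVorticity.NondegenerateCoordinates
      (ConstVorticity.profileW fun x => U (x + (c * t + x₀))) := by
    intro t
    have h := hW.comp_add hw.memLp (c * t + x₀)
    rwa [← funext (ConstVorticity.profileW_comp_add hU (c * t + x₀))] at h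
  -- For a travelling wave the time derivative is `c` times the space derivative, which turns the
  -- evolution equations into the profile equations.
  have hd : ∀ (f : ℝ → ℂ), ConstVorticity.MemH 2 f → ∀ α t : ℝ,
      deriv (fun s => f (α + c * s + x₀)) t = c * deriv (fun β => f (β + c * t + x₀)) α := by
    intro f hf α t
    have h1 : HasDerivAt (fun s : ℝ => α + c * s + x₀) c t := by
      simpa using (((hasDerivAt_id t).const_mul c).const_add α).add_const x₀
    have h2 : HasDerivAt (fun β : ℝ => β + c * t + x₀) 1 α :=
      ((hasDerivAt_id α).add_const (c * t)).add_const x₀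
    have h3 := (hf.hasDerivAt (α + c * t + x₀)).scomp t h1
    have h4 := (hf.hasDerivAt (α + c * t + x₀)).scomp α h2
    have e3 : deriv (fun s => f (α + c * s + x₀)) t = _ := h3.deriv
    have e4 : deriv (fun β => f (β + c * t + x₀)) α = _ := h4.deriv
    rw [e3, e4, one_smul, Complex.real_smul]
  refine ⟨fun h0 => hU0 ?_, ?_, ?_⟩
  · ext x
    -- Since `HU` is real, the imaginary part of the profile is `U` itself.
    have h := congrArg Complex.im (congrFun h0 (x - x₀))
    have hr : (ConstVorticity.hilbert (fun x => (U x : ℂ)) x).im = 0 :=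
      Complex.conj_eq_iff_im.1
        (ConstVorticity.hilbert_real hU (fun x => Complex.conj_ofReal _) x)
    simpa [ConstVorticity.profileW, hr] using h
  · exact hw.tendsto_zero.comp (Homeomorph.addRight x₀).isClosedEmbedding.tendsto_cocompact
  · constructor
    · exact hw.contDiff.comp (by fun_prop)
    · exact hq.contDiff.comp (by fun_prop)
    · intro t
      rw [eW]
      exact ConstVorticity.memH_profileW (hUt t)
    · intro t
      rw [eQ]
      exact ConstVorticity.memH_profileQ γ c (hUt t)
    · intro t
      rw [eW]
      exact (ConstVorticity.memH_profileW (hUt t)).proj_eq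
        (ConstVorticity.negFreq_profileW (hUt t))
    · intro t
      rw [eQ]
      exact (ConstVorticity.memH_profileQ γ c (hUt t)).proj_eq
        (ConstVorticity.negFreq_profileQ γ c (hUt t))
    · intro t
      rw [eW]
      exact hWt t
    · intro t
      filter_upwards [ConstVorticity.equation_W_profile (γ := γ) (c := c) (hUt t) (hWt t)]
        with α h
      rw [hd _ hw α t, congrFun (eW t) α, eW t, eQ t]
      exact h
    · intro t
      filter_upwards [ConstVorticity.equation_Q_profile (hUt t) (hB.comp_add hU _) (hWt t)]
        with α h
      rw [hd _ hq α t, congrFun (eW t) α, congrFun (eQ t) α, eW t, eQ t]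
      exact h
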